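/- Let $\ell\ge 2$, $\mathcal S=\{0,\dots,\ell-1\}$, and let $X=(X_k)_{k\ge1}$ be a homogeneous Markov chain on $\mathcal S$, with an arbitrary initial distribution, whose transition matrix $P=(p_{ij})$ is irreducible and satisfies $p_{ij}\neq 1$ for all $i,j\in\mathcal S$. For a word $\varepsilon_1\cdots\varepsilon_n$ over $\mathcal S$ let $$I_{\varepsilon_1\cdots\varepsilon_n}=\Big[\sum_{i=1}^n\frac{\varepsilon_i}{\ell^i},\ \sum_{i=1}^n\frac{\varepsilon_i}{\ell^i}+\frac1{\ell^n}\Big),$$ let $\mathcal F_n$ be the family of these $\ell$-adic intervals of order $n$, and for $x\in[0,1)$ let $I_n(x)$ be the interval of $\mathcal F_n$ that contains $x$. Then there is a unique Borel probability measure $m$ on $\mathbb R$ such that $$m(I_{\varepsilon_1\cdots\varepsilon_n})=\mathbb P(X_1=\varepsilon_1,\dots,X_n=\varepsilon_n)\qquad\text{for all words }\varepsilon_1\cdots\varepsilon_n .$$ Let $$\tau(q)=\limsup_{n\to\infty}\frac1{n\log\ell}\log\Big(\sum_{I\in\mathcal F_n}m(I)^q\Big),\qquad q\in\mathbb R,$$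 with the convention $0^q=0$ for every real $q$, and for $\alpha\in\mathbb R$ let $$E_\alpha=\Big\{x\in[0,1)\ ;\ \lim_{n\to\infty}\frac{\log m(I_n(x))}{\log|I_n(x)|}=\alpha\Big\},$$ where $\log 0=-\infty$. Then $\tau$ is differentiable on $\mathbb R$, the limits $\tau'(+\infty)=\lim_{q\to+\infty}\tau'(q)$ and $\tau'(-\infty)=\lim_{q\to-\infty}\tau'(q)$ exist and are finite, and $m$ satisfies the multifractal formalism: for every $\alpha$ with $-\tau'(+\infty)<\alpha<-\tau'(-\infty)$, $$\dim_H(E_\alpha)=\tau^*(\alpha):=\inf_{q\in\mathbb R}\big(\alpha q+\tau(q)\big).$$ -/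

import Mathlib

open MeasureTheory Filter Topology Set

noncomputable section

namespace MarkovMultifractal

/-- The process `X` (with times `0, 1, 2, …`) is a homogeneous Markov chain on `{0, …, ℓ - 1}`
with transition matrix `P`, under the probability measure `μ`. The initial distribution is the law
of `X 0`. The Markov property is written in product form, so that no conditioning on null events
occurs. -/
structure IsMarkovChain {Ω : Type*} [MeasurableSpace Ω] (μ : Measure Ω) {ℓ : ℕ}
    (P : Matrix (Fin ℓ) (Fin ℓ) ℝ) (X : ℕ → Ω → Fin ℓ) : Prop where
  measurable : ∀ n, Measurable (X n)
  stochastic : P ∈ Matrix.rowStochastic ℝ (Fin ℓ)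
  markov : ∀ (n : ℕ) (s : ℕ → Fin ℓ),
    μ.real {ω | ∀ k ≤ n + 1, X k ω = s k} =
      μ.real {ω | ∀ k ≤ n, X k ω = s k} * P (s n) (s (n + 1))

/-- The `ℓ`-adic interval `I_ε = [∑ ε_i ℓ^{-i}, ∑ ε_i ℓ^{-i} + ℓ^{-n})` of order `n` coded by the
word `ε = ε_1 ⋯ ε_n` (letters are indexed from `0` in the code). -/
def adicInterval {ℓ n : ℕ} (ε : Fin n → Fin ℓ) : Set ℝ :=
  Ico (∑ i : Fin n, ((ε i : ℕ) : ℝ) / (ℓ : ℝ) ^ ((i : ℕ) + 1))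
    (∑ i : Fin n, ((ε i : ℕ) : ℝ) / (ℓ : ℝ) ^ ((i : ℕ) + 1) + 1 / (ℓ : ℝ) ^ n)

/-- `I_n(x)`: the `ℓ`-adic interval of order `n` that contains `x`. -/
def adicCell (ℓ n : ℕ) (x : ℝ) : Set ℝ :=
  Ico ((⌊(ℓ : ℝ) ^ n * x⌋ : ℝ) / (ℓ : ℝ) ^ n) (((⌊(ℓ : ℝ) ^ n * x⌋ : ℝ) + 1) / (ℓ : ℝ) ^ n)

/-- `adicCell ℓ n x` is the interval of the family `I_ε`, `ε` of length `n`, that contains `x`. -/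
theorem adicCell_eq_adicInterval {ℓ n : ℕ} (hℓ : 0 < ℓ) (ε : Fin n → Fin ℓ) {x : ℝ}
    (hx : x ∈ adicInterval ε) : adicCell ℓ n x = adicInterval ε := by
  have hpos : (0 : ℝ) < (ℓ : ℝ) ^ n := by positivity
  have hℓ0 : (ℓ : ℝ) ≠ 0 := by positivity
  obtain ⟨z, hz⟩ : ∃ z : ℤ,
      ∑ i : Fin n, ((ε i : ℕ) : ℝ) / (ℓ : ℝ) ^ ((i : ℕ) + 1) = (z : ℝ) / (ℓ : ℝ) ^ n := by
    refine ⟨∑ i : Fin n, ((ε i : ℕ) : ℤ) * (ℓ : ℤ) ^ (n - ((i : ℕ) + 1)), ?_⟩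
    push_cast
    rw [Finset.sum_div]
    refine Finset.sum_congr rfl fun i _ => ?_
    rw [div_eq_div_iff (by positivity) (by positivity), mul_assoc, ← pow_add,
      Nat.sub_add_cancel (by omega)]
  rw [adicInterval, hz, ← add_div] at hx ⊢
  have hfl : ⌊(ℓ : ℝ) ^ n * x⌋ = z := by
    rw [Int.floor_eq_iff]
    obtain ⟨h1, h2⟩ := hx
    rw [div_le_iff₀ hpos] at h1
    rw [lt_div_iff₀ hpos] at h2
    constructor <;> linarith
  rw [adicCell, hfl]

/-- `m` is the measure associated with (driven by) the process `X`: the Borel probability measure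
on the line with `m(I_{ε_1⋯ε_n}) = μ(X_1 = ε_1, …, X_n = ε_n)` for every word. -/
structure IsDrivenMeasure {Ω : Type*} [MeasurableSpace Ω] (μ : Measure Ω) {ℓ : ℕ}
    (X : ℕ → Ω → Fin ℓ) (m : Measure ℝ) : Prop where
  isProbabilityMeasure : IsProbabilityMeasure m
  apply_adicInterval : ∀ (n : ℕ) (ε : Fin n → Fin ℓ),
    m (adicInterval ε) = μ {ω | ∀ i : Fin n, X i ω = ε i}

open Classical in
/-- `∑_{I ∈ F_n} m(I)^q`, with the convention `0^q = 0` for every real `q` (also `q ≤ 0`). -/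
def partitionSum (ℓ : ℕ) (m : Measure ℝ) (n : ℕ) (q : ℝ) : ℝ :=
  ∑ ε : Fin n → Fin ℓ,
    if m (adicInterval ε) = 0 then 0 else m.real (adicInterval ε) ^ q

/-- The structure function `τ`. -/
def structureFunction (ℓ : ℕ) (m : Measure ℝ) (q : ℝ) : ℝ :=
  limsup (fun n : ℕ => 1 / ((n : ℝ) * Real.log ℓ) * Real.log (partitionSum ℓ m n q)) atTop

/-- The Legendre transform `τ*(α) = inf_q (α q + τ(q))`, as an extended real number. -/
def legendre (τ : ℝ → ℝ) (α : ℝ) : EReal :=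
  ⨅ q : ℝ, ((α * q + τ q : ℝ) : EReal)

/-- The level set `E_α`. If `m(I_n(x)) = 0` for some `n`, the quotient of logarithms is eventually
`+∞`, and `x` belongs to no `E_α` with `α` real; hence the positivity clause. The right end point
`1` lies in no `ℓ`-adic subinterval of `[0, 1)`. -/
def levelSet (ℓ : ℕ) (m : Measure ℝ) (α : ℝ) : Set ℝ :=
  {x | x ∈ Ico (0 : ℝ) 1 ∧ (∀ n : ℕ, 0 < m (adicCell ℓ n x)) ∧
    Tendsto (fun n : ℕ => Real.log (m.real (adicCell ℓ n x)) /
      Real.log (volume.real (adicCell ℓ n x))) atTop (𝓝 α)}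

end MarkovMultifractal

end

/-!
Let `r(q)` be the Perron root of the irreducible matrix `A_q = (p_ij^q)` (with `0^q = 0`). Summing
the weights `m(I)^q` against a positive eigenvector of `A_q` gives an exact geometric progression,
so the partition sums are comparable to `r(q)^n` and `τ(q) = log r(q) / log ℓ`
(`partitionSum_bounds`, `tendsto_log_partitionSum`).

*Regularity of `τ`.* Existence of positive left and right eigenvectors `u_q`, `v_q` is proved by
maximizing `r` subject to `r x ≤ A x` over the simplex (`exists_perron`). The normalized right
eigenvector is unique, hence depends continuously on `q` by compactness, and the identity
`(r(t) - r(q)) u_q·v_t = u_q·(A_t - A_q) v_t` gives the derivative of `r`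
(`hasDerivAt_perron_root`). The formula exhibits `τ'` as a weighted mean of the numbers
`log p_ij / log ℓ`, so `τ'` is bounded. Hölder's inequality for partition sums makes `τ` convex, so
`τ'` is monotone and has finite limits at `±∞`. By Darboux's theorem every `α` strictly between
`-τ'(+∞)` and `-τ'(-∞)` is `-τ'(q)` for some `q`, and by convexity `τ*(α) = αq + τ(q)`.

*Dimension of the level sets.* Covering the level set by `ℓ`-adic intervals with
`m(I) ≈ ℓ^{-nα}` bounds its dimension above by `αq + τ(q)` (`dimH_levelSet_le`). For the lower
bound, the Markov chain with transitions `p_ij^q v_j / (r v_i)` drives a Gibbs measure `ν` with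
`ν(I) ≤ C m(I)^q ℓ^{-nτ(q)}` (`exists_gibbs_measure`). Under `ν` the exponential moments of
`log m(I_n(x))` are partition sums at nearby exponents, so that differentiability of `τ` at `q`,
Chernoff's bound and the Borel–Cantelli lemma show that `ν` is carried by the level set
(`ae_mem_levelSet_of_gibbs`). There `ν(I_n(x)) ≤ ℓ^{-n(αq + τ(q) - o(1))}`, and the mass
distribution principle `le_dimH_of_measure_adicCell_le` concludes.

*Existence of driven measures.* The measure driven by a chain is the law of the number with random
digits `X 0, X 1, …`. Its `ℓ`-adic intervals have the required masses because almost surely the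
digits do not end in a constant sequence `ℓ - 1`: no state is absorbing
(`exists_isDrivenMeasure`, `IsMarkovChain.ae_exists_ne`).
-/

noncomputable section

namespace MarkovMultifractal

/-! ### Perron eigenvectors of irreducible matrices -/

section Perron

open Matrix

variable {n : Type*} [Fintype n] {A : Matrix n n ℝ}

theorem mulVec_nonneg {x : n → ℝ} (hA : ∀ i j, 0 ≤ A i j) (hx : ∀ i, 0 ≤ x i) (i : n) :
    0 ≤ (A *ᵥ x) i :=
  Finset.sum_nonneg fun j _ => mul_nonneg (hA i j) (hx j)

theorem mulVec_pos_of_entry_pos {x : n → ℝ} (hA : ∀ i j, 0 ≤ A i j) (hx : ∀ i, 0 ≤ x i)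
    {i j : n} (hij : 0 < A i j) (hj : 0 < x j) : 0 < (A *ᵥ x) i :=
  Finset.sum_pos' (fun k _ => mul_nonneg (hA i k) (hx k)) ⟨j, Finset.mem_univ j, mul_pos hij hj⟩

theorem pow_mulVec_eq_of_eigenvector [DecidableEq n] {r : ℝ} {x : n → ℝ}
    (h : A *ᵥ x = r • x) (k : ℕ) : (A ^ k) *ᵥ x = r ^ k • x := by
  induction k with
  | zero => simp
  | succ k ih => rw [pow_succ, ← mulVec_mulVec, h, mulVec_smul, ih, smul_smul, pow_succ, mul_comm]

/-- A nonzero nonnegative eigenvector of an irreducible matrix has no zero coordinate. -/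
theorem eigenvector_pos_of_nonneg [DecidableEq n] (hA : A.IsIrreducible) {r : ℝ} {x : n → ℝ}
    (h : A *ᵥ x = r • x) (hx : ∀ i, 0 ≤ x i) (hx0 : x ≠ 0) (i : n) : 0 < x i := by
  obtain ⟨j, hj⟩ := Function.ne_iff.1 hx0
  obtain ⟨k, -, hk⟩ := (isIrreducible_iff_exists_pow_pos hA.nonneg).1 hA i j
  have h1 : 0 < ((A ^ k) *ᵥ x) i :=
    mulVec_pos_of_entry_pos (fun a b => pow_apply_nonneg hA.nonneg k a b) hx hk
      (lt_of_le_of_ne (hx j) (Ne.symm hj))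
  rw [pow_mulVec_eq_of_eigenvector h] at h1
  rcases (hx i).lt_or_eq with h2 | h2
  · exact h2
  · simp [← h2] at h1

theorem eigenvalue_pos [DecidableEq n] (hA : A.IsIrreducible) [Nonempty n] {r : ℝ} {x : n → ℝ}
    (h : A *ᵥ x = r • x) (hx : ∀ i, 0 < x i) : 0 < r := by
  obtain ⟨i⟩ := ‹Nonempty n›
  obtain ⟨k, hk, hpos⟩ := (isIrreducible_iff_exists_pow_pos hA.nonneg).1 hA i i
  have h0 : 0 ≤ r := by
    have := mulVec_nonneg hA.nonneg (fun j => (hx j).le) i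
    rw [h] at this
    exact nonneg_of_mul_nonneg_left this (hx i)
  have h1 : 0 < ((A ^ k) *ᵥ x) i :=
    mulVec_pos_of_entry_pos (fun a b => pow_apply_nonneg hA.nonneg k a b) (fun j => (hx j).le)
      hpos (hx i)
  rw [pow_mulVec_eq_of_eigenvector h] at h1
  rcases h0.lt_or_eq with h2 | h2
  · exact h2
  · simp [← h2, hk.ne'] at h1

theorem exists_sum_pow_pos [DecidableEq n] (hA : A.IsIrreducible) :
    ∃ K : ℕ, ∀ i j, 0 < (∑ k ∈ Finset.range K, A ^ k) i j := by
  choose k hk hpos using (isIrreducible_iff_exists_pow_pos hA.nonneg).1 hA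
  refine ⟨(Finset.univ.sup fun p : n × n => k p.1 p.2) + 1, fun i j => ?_⟩
  rw [Matrix.sum_apply]
  refine Finset.sum_pos' (fun l _ => pow_apply_nonneg hA.nonneg l i j) ⟨k i j, ?_, hpos i j⟩
  rw [Finset.mem_range, Nat.lt_succ_iff]
  exact Finset.le_sup (f := fun p : n × n => k p.1 p.2) (Finset.mem_univ (i, j))

/-- If `r x ≤ A x` with `x` in the simplex and `A x ≠ r x`, then `r` can be increased: a sum `B` of
powers of `A` with positive entries commutes with `A` and makes the inequality for `B x` strict in
every coordinate. -/
theorem exists_larger_subeigenvalue [DecidableEq n] (hA : A.IsIrreducible) {r : ℝ} {x : n → ℝ}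
    (hx : x ∈ stdSimplex ℝ n) (h : ∀ i, r * x i ≤ (A *ᵥ x) i) (hne : A *ᵥ x ≠ r • x) :
    ∃ r' > r, ∃ y ∈ stdSimplex ℝ n, ∀ i, r' * y i ≤ (A *ᵥ y) i := by
  obtain ⟨K, hB⟩ := exists_sum_pow_pos hA
  set B := ∑ k ∈ Finset.range K, A ^ k with hBdef
  have hcomm : A * B = B * A := by
    simp only [hBdef, Finset.mul_sum, Finset.sum_mul, ← pow_succ, ← pow_succ']
  have hxne : x ≠ 0 := by
    rintro rfl
    simpa using hx.2
  obtain ⟨j, hj⟩ := Function.ne_iff.1 hxne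
  obtain ⟨l, hl⟩ := Function.ne_iff.1 hne
  set y := B *ᵥ x with hy
  have hypos : ∀ i, 0 < y i := fun i =>
    mulVec_pos_of_entry_pos (fun a b => (hB a b).le) hx.1 (hB i j)
      (lt_of_le_of_ne (hx.1 j) (Ne.symm hj))
  have hz : ∀ i, 0 < (B *ᵥ (A *ᵥ x - r • x)) i := fun i =>
    mulVec_pos_of_entry_pos (fun a b => (hB a b).le)
      (fun i => by simpa using h i) (hB i l)
      (by
        have := lt_of_le_of_ne (h l) (fun e => hl (by simpa using e.symm))
        simpa using this)
  have hz' : ∀ i, 0 < (A *ᵥ y) i - r * y i := by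
    intro i
    have := hz i
    rwa [mulVec_sub, mulVec_smul, mulVec_mulVec, ← hcomm, ← mulVec_mulVec] at this
  have : Nonempty n := ⟨j⟩
  obtain ⟨i₀, hi₀⟩ := Finite.exists_min fun i => ((A *ᵥ y) i - r * y i) / y i
  have hδ : 0 < ((A *ᵥ y) i₀ - r * y i₀) / y i₀ := div_pos (hz' i₀) (hypos i₀)
  have hs : 0 < ∑ i, y i := Finset.sum_pos (fun i _ => hypos i) Finset.univ_nonempty
  refine ⟨r + ((A *ᵥ y) i₀ - r * y i₀) / y i₀, by linarith, (∑ i, y i)⁻¹ • y,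
    ⟨fun i => mul_nonneg (inv_pos.2 hs).le (hypos i).le, ?_⟩, fun i => ?_⟩
  · simp only [Pi.smul_apply, smul_eq_mul, ← Finset.mul_sum]
    exact inv_mul_cancel₀ hs.ne'
  · rw [mulVec_smul]
    simp only [Pi.smul_apply, smul_eq_mul]
    have h1 := hi₀ i
    rw [le_div_iff₀ (hypos i)] at h1
    have h2 : (r + ((A *ᵥ y) i₀ - r * y i₀) / y i₀) * y i ≤ (A *ᵥ y) i := by linarith
    calc _ = (∑ i, y i)⁻¹ * ((r + ((A *ᵥ y) i₀ - r * y i₀) / y i₀) * y i) := by ring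
      _ ≤ _ := mul_le_mul_of_nonneg_left h2 (inv_pos.2 hs).le

theorem continuous_mulVec_apply (A : Matrix n n ℝ) (i : n) :
    Continuous fun x : n → ℝ => (A *ᵥ x) i :=
  (continuous_apply i).comp (Continuous.matrix_mulVec continuous_const continuous_id)

/-- **Perron's theorem** (existence part). The eigenvalue is the maximum of all `r` for which
`r x ≤ A x` has a solution in the simplex (Collatz–Wielandt). -/
theorem exists_perron [DecidableEq n] [Nonempty n] (hA : A.IsIrreducible) :
    ∃ r : ℝ, 0 < r ∧ ∃ v ∈ stdSimplex ℝ n, (∀ i, 0 < v i) ∧ A *ᵥ v = r • v := by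
  set M := ∑ i, ∑ j, A i j with hM
  set S : Set (ℝ × (n → ℝ)) :=
    (Icc 0 M ×ˢ stdSimplex ℝ n) ∩ {p | ∀ i, p.1 * p.2 i ≤ (A *ᵥ p.2) i} with hS
  have hbound : ∀ r x, x ∈ stdSimplex ℝ n → (∀ i, r * x i ≤ (A *ᵥ x) i) → r ≤ M := by
    intro r x hx h
    calc r = ∑ i, r * x i := by rw [← Finset.mul_sum, hx.2, mul_one]
      _ ≤ ∑ i, (A *ᵥ x) i := Finset.sum_le_sum fun i _ => h i
      _ ≤ M := Finset.sum_le_sum fun i _ => Finset.sum_le_sum fun j _ =>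
          mul_le_of_le_one_right (hA.nonneg i j)
            (hx.2 ▸ Finset.single_le_sum (fun k _ => hx.1 k) (Finset.mem_univ j))
  have hcompact : IsCompact S := by
    refine (isCompact_Icc.prod (isCompact_stdSimplex ℝ n)).inter_right ?_
    simp only [ofPred_forall]
    refine isClosed_iInter fun i => isClosed_le ?_ ?_
    · fun_prop
    · exact (continuous_mulVec_apply A i).comp continuous_snd
  have hM0 : 0 ≤ M := Finset.sum_nonneg fun i _ => Finset.sum_nonneg fun j _ => hA.nonneg i j
  have hne : S.Nonempty := by
    obtain ⟨i⟩ := ‹Nonempty n›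
    refine ⟨(0, Pi.single i 1), ⟨⟨⟨le_rfl, hM0⟩, single_mem_stdSimplex ℝ i⟩, fun k => ?_⟩⟩
    simpa using mulVec_nonneg hA.nonneg (single_mem_stdSimplex ℝ i).1 k
  obtain ⟨⟨r, x⟩, ⟨⟨hr, hx⟩, hrx⟩, hmax⟩ := hcompact.exists_isMaxOn hne continuous_fst.continuousOn
  have heq : A *ᵥ x = r • x := by
    by_contra hcon
    obtain ⟨r', hr', y, hy, h'⟩ := exists_larger_subeigenvalue hA hx hrx hcon
    have : r' ≤ r := hmax (a := (r', y)) ⟨⟨⟨hr.1.trans hr'.le, hbound r' y hy h'⟩, hy⟩, h'⟩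
    linarith
  have hxne : x ≠ 0 := by
    rintro rfl
    simpa using hx.2
  have hpos := eigenvector_pos_of_nonneg hA heq hx.1 hxne
  exact ⟨r, eigenvalue_pos hA heq hpos, x, hx, hpos, heq⟩

/-- A positive left eigenvector and a nonzero nonnegative right eigenvector have the same
eigenvalue. -/
theorem left_right_eigenvalue_eq {r s : ℝ} {u v : n → ℝ} (hu : ∀ i, 0 < u i)
    (hv : v ∈ stdSimplex ℝ n) (hAu : u ᵥ* A = s • u) (hAv : A *ᵥ v = r • v) : s = r := by
  have hpos : 0 < u ⬝ᵥ v := by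
    have hvne : v ≠ 0 := by
      rintro rfl
      simpa using hv.2
    obtain ⟨j, hj⟩ := Function.ne_iff.1 hvne
    exact Finset.sum_pos' (fun i _ => mul_nonneg (hu i).le (hv.1 i))
      ⟨j, Finset.mem_univ j, mul_pos (hu j) (lt_of_le_of_ne (hv.1 j) (Ne.symm hj))⟩
  have := dotProduct_mulVec u A v
  rw [hAu, hAv, dotProduct_smul, smul_dotProduct] at this
  exact (mul_right_cancel₀ hpos.ne' this).symm

/-- Both Perron eigenvectors of an irreducible matrix. -/
theorem exists_perron_left_right [DecidableEq n] [Nonempty n] (hA : A.IsIrreducible) :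
    ∃ r : ℝ, 0 < r ∧ ∃ v ∈ stdSimplex ℝ n, ∃ u : n → ℝ,
      (∀ i, 0 < v i) ∧ (∀ i, 0 < u i) ∧ A *ᵥ v = r • v ∧ u ᵥ* A = r • u := by
  obtain ⟨r, hr, v, hv, hvpos, hAv⟩ := exists_perron hA
  obtain ⟨s, -, u, -, hupos, hAu⟩ := exists_perron hA.transpose
  rw [mulVec_transpose] at hAu
  rw [left_right_eigenvalue_eq hupos hv hAu hAv] at hAu
  exact ⟨r, hr, v, hv, u, hvpos, hupos, hAv, hAu⟩

/-- Uniqueness of the Perron vector: subtract the largest multiple that keeps the difference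
nonnegative. -/
theorem perron_vector_unique [DecidableEq n] (hA : A.IsIrreducible) {r : ℝ} {v w : n → ℝ}
    (hv : v ∈ stdSimplex ℝ n) (hw : w ∈ stdSimplex ℝ n) (hvpos : ∀ i, 0 < v i)
    (hAv : A *ᵥ v = r • v) (hAw : A *ᵥ w = r • w) : w = v := by
  have hne : Nonempty n := by
    by_contra h
    rw [not_nonempty_iff] at h
    simpa using hv.2
  obtain ⟨i₀, hi₀⟩ := Finite.exists_min fun i => w i / v i
  set c := w i₀ / v i₀ with hc
  have hd : ∀ i, 0 ≤ (w - c • v) i := by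
    intro i
    have := hi₀ i
    rw [le_div_iff₀ (hvpos i)] at this
    simpa using this
  have hAd : A *ᵥ (w - c • v) = r • (w - c • v) := by
    rw [mulVec_sub, mulVec_smul, hAv, hAw, smul_sub, smul_comm]
  have hzero : w - c • v = 0 := by
    by_contra hcon
    have := eigenvector_pos_of_nonneg hA hAd hd hcon i₀
    simp [hc, div_mul_cancel₀ _ (hvpos i₀).ne'] at this
  have hwc : w = c • v := sub_eq_zero.1 hzero
  have hc1 : c = 1 := by
    have := hw.2
    rw [hwc] at this
    simpa [← Finset.mul_sum, hv.2] using this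
  rw [hwc, hc1, one_smul]

/-- A normalized Perron vector of an irreducible matrix depends continuously on the matrix: the
simplex is compact, and every cluster point is again a normalized Perron vector. -/
theorem continuousAt_perron_vector [DecidableEq n]
    {A : ℝ → Matrix n n ℝ} {r : ℝ → ℝ} {v : ℝ → n → ℝ}
    (hirr : ∀ q, (A q).IsIrreducible) (hv : ∀ q, v q ∈ stdSimplex ℝ n)
    (hvpos : ∀ q i, 0 < v q i) (hAv : ∀ q, A q *ᵥ v q = r q • v q)
    {q : ℝ} (hA : ContinuousAt A q) : ContinuousAt v q := by
  have hr : ∀ t, r t = ∑ i, (A t *ᵥ v t) i := by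
    intro t
    rw [hAv]
    simp [← Finset.mul_sum, (hv t).2]
  refine (isCompact_stdSimplex ℝ n).tendsto_nhds_of_unique_mapClusterPt
    (Eventually.of_forall hv) fun w hw hcl => ?_
  obtain ⟨f, hfq, hfw⟩ := mapClusterPt_iff_ultrafilter.1 hcl
  have hAf : Tendsto A f (𝓝 (A q)) := hA.tendsto.mono_left hfq
  have h1 : Tendsto (fun t => A t *ᵥ v t) f (𝓝 (A q *ᵥ w)) :=
    ((continuous_fst.matrix_mulVec continuous_snd).tendsto (A q, w)).comp
      (hAf.prodMk_nhds hfw)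
  have h2 : Tendsto r f (𝓝 (∑ i, (A q *ᵥ w) i)) := by
    simp only [funext hr]
    exact tendsto_finsetSum _ fun i _ => (tendsto_pi_nhds.1 h1) i
  have h3 : A q *ᵥ w = (∑ i, (A q *ᵥ w) i) • w := by
    refine tendsto_nhds_unique h1 ?_
    simp only [hAv]
    exact h2.smul hfw
  have hwne : w ≠ 0 := by
    rintro rfl
    simpa using hw.2
  have hwpos := eigenvector_pos_of_nonneg (hirr q) h3 hw.1 hwne
  obtain ⟨s, -, v', hv', u, -, hu, -, hAu⟩ : ∃ r : ℝ, 0 < r ∧ ∃ v ∈ stdSimplex ℝ n, ∃ u : n → ℝ,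
      (∀ i, 0 < v i) ∧ (∀ i, 0 < u i) ∧ A q *ᵥ v = r • v ∧ u ᵥ* A q = r • u := by
    have : Nonempty n := by
      by_contra h
      rw [not_nonempty_iff] at h
      simpa using hw.2
    exact exists_perron_left_right (hirr q)
  have e1 := left_right_eigenvalue_eq hu hw hAu h3
  have e2 := left_right_eigenvalue_eq hu (hv q) hAu (hAv q)
  rw [← e1, e2] at h3
  exact perron_vector_unique (hirr q) (hv q) hw (hvpos q) (hAv q) h3

/-- The Perron root is differentiable along a differentiable family of irreducible matrices; the
formula comes from pairing `(A t - A q) v_t` with the left eigenvector at `q`. -/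
theorem hasDerivAt_perron_root [DecidableEq n]
    {A : ℝ → Matrix n n ℝ} {r : ℝ → ℝ} {v : ℝ → n → ℝ} {u : n → ℝ}
    (hirr : ∀ q, (A q).IsIrreducible) (hv : ∀ q, v q ∈ stdSimplex ℝ n)
    (hvpos : ∀ q i, 0 < v q i) (hupos : ∀ i, 0 < u i)
    (hAv : ∀ q, A q *ᵥ v q = r q • v q) {q : ℝ}
    (hAu : u ᵥ* A q = r q • u) {A' : Matrix n n ℝ}
    (hA : ∀ i j, HasDerivAt (fun t => A t i j) (A' i j) q) :
    HasDerivAt r ((u ⬝ᵥ A' *ᵥ v q) / (u ⬝ᵥ v q)) q := by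
  have hcont : ContinuousAt v q := continuousAt_perron_vector hirr hv hvpos hAv
    (continuousAt_pi.2 fun i => continuousAt_pi.2 fun j => (hA i j).continuousAt)
  have hne : Nonempty n := by
    by_contra h
    rw [not_nonempty_iff] at h
    simpa using (hv q).2
  have hpos : ∀ t, 0 < u ⬝ᵥ v t := fun t =>
    Finset.sum_pos (fun i _ => mul_pos (hupos i) (hvpos t i)) Finset.univ_nonempty
  rw [hasDerivAt_iff_tendsto_slope]
  have hslope : ∀ t, slope r q t =
      (u ⬝ᵥ (fun i => ∑ j, slope (fun t => A t i j) q t * v t j)) / (u ⬝ᵥ v t) := by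
    intro t
    rw [eq_div_iff (hpos t).ne']
    have h1 : u ⬝ᵥ ((A t - A q) *ᵥ v t) = (r t - r q) * (u ⬝ᵥ v t) := by
      rw [sub_mulVec, dotProduct_sub, hAv, dotProduct_mulVec u (A q), hAu, dotProduct_smul,
        smul_dotProduct, smul_eq_mul, smul_eq_mul, sub_mul]
    have h2 : u ⬝ᵥ (fun i => ∑ j, slope (fun t => A t i j) q t * v t j)
        = (t - q)⁻¹ * (u ⬝ᵥ ((A t - A q) *ᵥ v t)) := by
      simp only [dotProduct, mulVec, slope, vsub_eq_sub, smul_eq_mul, Matrix.sub_apply,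
        Finset.mul_sum]
      exact Finset.sum_congr rfl fun i _ => Finset.sum_congr rfl fun j _ => by ring
    rw [h2, h1, slope, vsub_eq_sub, smul_eq_mul, mul_assoc]
  simp only [funext hslope]
  have hv' : ∀ j, Tendsto (fun t => v t j) (𝓝[≠] q) (𝓝 (v q j)) := fun j =>
    (tendsto_pi_nhds.1 hcont.tendsto j).mono_left nhdsWithin_le_nhds
  refine Tendsto.div ?_ ?_ (hpos q).ne'
  · refine tendsto_finsetSum _ fun i _ => Tendsto.const_mul _ (tendsto_finsetSum _ fun j _ => ?_)
    exact (hasDerivAt_iff_tendsto_slope.1 (hA i j)).mul (hv' j)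
  · exact tendsto_finsetSum _ fun i _ => (hv' i).const_mul _

end Perron

/-! ### `ℓ`-adic intervals and driven measures -/

section Adic

variable {ℓ : ℕ}

theorem measurableSet_adicInterval {n : ℕ} (ε : Fin n → Fin ℓ) : MeasurableSet (adicInterval ε) :=
  measurableSet_Ico

/-- Left end points are numbered by reading the word as an integer in base `ℓ`;
`finFunctionFinEquiv` puts the least significant digit first, whence the reversal. -/
theorem sum_letters_eq_finFunctionFinEquiv_div (hℓ : 0 < ℓ) {n : ℕ} (ε : Fin n → Fin ℓ) :
    ∑ i : Fin n, ((ε i : ℕ) : ℝ) / (ℓ : ℝ) ^ ((i : ℕ) + 1) =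
      ((finFunctionFinEquiv (ε ∘ Fin.rev) : ℕ) : ℝ) / (ℓ : ℝ) ^ n := by
  rw [finFunctionFinEquiv_apply, Nat.cast_sum, Finset.sum_div, ← Equiv.sum_comp Fin.revPerm]
  refine Finset.sum_congr rfl fun i _ => ?_
  simp only [Fin.revPerm_apply, Function.comp_apply, Nat.cast_mul, Nat.cast_pow, Fin.val_rev]
  rw [div_eq_div_iff (by positivity) (by positivity), mul_assoc, ← pow_add]
  congr 2
  omega

theorem eq_of_mem_adicInterval (hℓ : 0 < ℓ) {n : ℕ} {ε δ : Fin n → Fin ℓ} {x : ℝ}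
    (hε : x ∈ adicInterval ε) (hδ : x ∈ adicInterval δ) : ε = δ := by
  have h := (adicCell_eq_adicInterval hℓ ε hε).symm.trans (adicCell_eq_adicInterval hℓ δ hδ)
  have hpos : (0 : ℝ) < 1 / (ℓ : ℝ) ^ n := by positivity
  have h1 := congrArg sInf h
  rw [adicInterval, adicInterval, csInf_Ico (by linarith), csInf_Ico (by linarith),
    sum_letters_eq_finFunctionFinEquiv_div hℓ, sum_letters_eq_finFunctionFinEquiv_div hℓ,
    div_left_inj' (by positivity), Nat.cast_inj, Fin.val_inj, EmbeddingLike.apply_eq_iff_eq] at h1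
  exact Fin.rev_surjective.injective_comp_right h1

theorem disjoint_adicInterval (hℓ : 0 < ℓ) {n : ℕ} :
    Pairwise (Function.onFun Disjoint fun ε : Fin n → Fin ℓ => adicInterval ε) :=
  fun _ _ hne => disjoint_left.2 fun _ h1 h2 => hne (eq_of_mem_adicInterval hℓ h1 h2)

theorem adicInterval_subset_Ico (hℓ : 0 < ℓ) {n : ℕ} (ε : Fin n → Fin ℓ) :
    adicInterval ε ⊆ Ico 0 1 := by
  rw [adicInterval, sum_letters_eq_finFunctionFinEquiv_div hℓ, ← add_div]
  refine Ico_subset_Ico (by positivity) ?_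
  rw [div_le_one (by positivity)]
  exact_mod_cast (finFunctionFinEquiv (ε ∘ Fin.rev)).2

theorem exists_mem_adicInterval (hℓ : 0 < ℓ) (n : ℕ) {x : ℝ} (hx : x ∈ Ico (0 : ℝ) 1) :
    ∃ ε : Fin n → Fin ℓ, x ∈ adicInterval ε := by
  have : NeZero ℓ := ⟨hℓ.ne'⟩
  refine ⟨fun i => Real.digits x ℓ i, ?_⟩
  have h := Real.ofDigits_digits_sum_eq (b := ℓ) hx n
  have hpos : (0 : ℝ) < (ℓ : ℝ) ^ n := by positivity
  rw [Finset.sum_range] at h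
  have hsum : ∑ i : Fin n, ((Real.digits x ℓ i : ℕ) : ℝ) / (ℓ : ℝ) ^ ((i : ℕ) + 1)
      = (⌊(ℓ : ℝ) ^ n * x⌋₊ : ℝ) / (ℓ : ℝ) ^ n := by
    rw [← h, mul_div_cancel_left₀ _ hpos.ne']
    rfl
  rw [adicInterval, hsum, ← add_div, mem_Ico, div_le_iff₀ hpos, lt_div_iff₀ hpos, mul_comm x]
  exact ⟨Nat.floor_le (mul_nonneg hpos.le hx.1), Nat.lt_floor_add_one _⟩

theorem iUnion_adicInterval (hℓ : 0 < ℓ) (n : ℕ) :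
    ⋃ ε : Fin n → Fin ℓ, adicInterval ε = Ico 0 1 :=
  subset_antisymm (iUnion_subset fun ε => adicInterval_subset_Ico hℓ ε)
    fun _ hx => mem_iUnion.2 (exists_mem_adicInterval hℓ n hx)

theorem adicInterval_zero (ε : Fin 0 → Fin ℓ) : adicInterval ε = Ico 0 1 := by
  simp [adicInterval]

theorem exists_adicInterval_eq_adicCell (hℓ : 0 < ℓ) (n : ℕ) {x : ℝ} (hx : x ∈ Ico (0 : ℝ) 1) :
    ∃ ε : Fin n → Fin ℓ, x ∈ adicInterval ε ∧ adicCell ℓ n x = adicInterval ε := by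
  obtain ⟨ε, hε⟩ := exists_mem_adicInterval hℓ n hx
  exact ⟨ε, hε, adicCell_eq_adicInterval hℓ ε hε⟩

theorem abs_sub_le_of_mem_adicInterval {n : ℕ} {ε : Fin n → Fin ℓ} {x y : ℝ}
    (hx : x ∈ adicInterval ε) (hy : y ∈ adicInterval ε) : |x - y| ≤ ((ℓ : ℝ) ^ n)⁻¹ := by
  rw [adicInterval, mem_Ico, one_div] at hx hy
  rw [abs_le]
  constructor <;> linarith [hx.1, hx.2, hy.1, hy.2]

/-- Two finite measures carried by `[0, 1)` that agree on the `ℓ`-adic intervals are equal: the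
integral of a bounded continuous function is the limit of Riemann sums over these intervals. -/
theorem measure_eq_of_adicInterval (hℓ : 2 ≤ ℓ) {m m' : Measure ℝ} [IsFiniteMeasure m]
    [IsFiniteMeasure m'] (hm : m (Ico 0 1)ᶜ = 0) (hm' : m' (Ico 0 1)ᶜ = 0)
    (h : ∀ (n : ℕ) (ε : Fin n → Fin ℓ), m (adicInterval ε) = m' (adicInterval ε)) : m = m' := by
  have hℓ0 : 0 < ℓ := by omega
  let c : (n : ℕ) → (Fin n → Fin ℓ) → ℝ := fun n ε =>
    ∑ i : Fin n, ((ε i : ℕ) : ℝ) / (ℓ : ℝ) ^ ((i : ℕ) + 1)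
  have hc : ∀ n ε, c n ε ∈ adicInterval ε := fun n ε =>
    left_mem_Ico.2 (by have : (0 : ℝ) < 1 / (ℓ : ℝ) ^ n := by positivity
                       linarith)
  let f : ℕ → ℝ → ℝ := fun n x => (⌊(ℓ : ℝ) ^ n * x⌋ : ℝ) / (ℓ : ℝ) ^ n
  have hf : ∀ n (ε : Fin n → Fin ℓ), ∀ x ∈ adicInterval ε, f n x = c n ε := by
    intro n ε x hx
    have hpos : (0 : ℝ) < 1 / (ℓ : ℝ) ^ n := by positivity
    have h1 := congrArg sInf (adicCell_eq_adicInterval hℓ0 ε hx)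
    rwa [adicInterval, adicCell, add_div, csInf_Ico (by linarith), csInf_Ico (by linarith)] at h1
  have key : ∀ (ν : Measure ℝ) [IsFiniteMeasure ν], ν (Ico 0 1)ᶜ = 0 →
      ∀ g : BoundedContinuousFunction ℝ ℝ,
      Tendsto (fun n => ∑ ε : Fin n → Fin ℓ, ν.real (adicInterval ε) * g (c n ε)) atTop
        (𝓝 (∫ x, g x ∂ν)) := by
    intro ν _ hν g
    have hsum : ∀ n, ∑ ε : Fin n → Fin ℓ, ν.real (adicInterval ε) * g (c n ε)
        = ∫ x, g (f n x) ∂ν := by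
      intro n
      have hae : ν.restrict (Ico 0 1) = ν := Measure.restrict_eq_self_of_ae_mem hν
      have hon : ∀ ε : Fin n → Fin ℓ, EqOn (fun x => g (f n x)) (fun _ => g (c n ε))
          (adicInterval ε) := fun ε x hx => congrArg g (hf n ε x hx)
      conv_rhs => rw [← hae, ← iUnion_adicInterval hℓ0 n]
      rw [integral_iUnion_fintype (fun ε => measurableSet_adicInterval ε)
        (disjoint_adicInterval hℓ0) (fun ε =>
          (integrableOn_congr_fun (hon ε) (measurableSet_adicInterval ε)).2
            (integrable_const _))]
      refine Finset.sum_congr rfl fun ε _ => ?_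
      rw [setIntegral_congr_fun (measurableSet_adicInterval ε) (hon ε)]
      simp
    simp only [hsum]
    refine tendsto_integral_of_dominated_convergence (fun _ => ‖g‖) (fun n => ?_)
      (integrable_const _) (fun n => Eventually.of_forall fun x => g.norm_coe_le_norm _) ?_
    · refine (g.continuous.measurable.comp ?_).aestronglyMeasurable
      exact ((measurable_from_top (f := fun z : ℤ => (z : ℝ))).comp
        (Int.measurable_floor.comp (measurable_const_mul _))).div_const _
    · have hν' : ∀ᵐ x ∂ν, x ∈ Ico (0 : ℝ) 1 := hν
      filter_upwards [hν'] with x hx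
      refine (g.continuous.tendsto x).comp ?_
      rw [tendsto_iff_dist_tendsto_zero]
      refine squeeze_zero (fun _ => dist_nonneg) (fun n => ?_)
        (tendsto_inv_atTop_zero.comp (tendsto_pow_atTop_atTop_of_one_lt
          (show (1 : ℝ) < ℓ by exact_mod_cast hℓ)))
      obtain ⟨ε, hε⟩ := exists_mem_adicInterval hℓ0 n hx
      rw [hf n ε x hε]
      exact abs_sub_le_of_mem_adicInterval (hc n ε) hε
  refine ext_of_forall_integral_eq_of_IsFiniteMeasure fun g =>
    tendsto_nhds_unique (key m hm g) ?_
  simp only [measureReal_def, h]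
  exact key m' hm' g

theorem IsDrivenMeasure.compl_Ico {Ω : Type*} [MeasurableSpace Ω] {μ : Measure Ω}
    [IsProbabilityMeasure μ] {X : ℕ → Ω → Fin ℓ} {m : Measure ℝ} (h : IsDrivenMeasure μ X m) :
    m (Ico 0 1)ᶜ = 0 := by
  have := h.isProbabilityMeasure
  have h0 := h.apply_adicInterval 0 Fin.elim0
  rw [adicInterval_zero] at h0
  rw [prob_compl_eq_zero_iff measurableSet_Ico, h0]
  simp

theorem IsDrivenMeasure.unique (hℓ : 2 ≤ ℓ) {Ω : Type*} [MeasurableSpace Ω] {μ : Measure Ω}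
    [IsProbabilityMeasure μ] {X : ℕ → Ω → Fin ℓ} {m m' : Measure ℝ} (h : IsDrivenMeasure μ X m)
    (h' : IsDrivenMeasure μ X m') : m = m' := by
  have := h.isProbabilityMeasure
  have := h'.isProbabilityMeasure
  exact measure_eq_of_adicInterval hℓ h.compl_Ico h'.compl_Ico fun n ε => by
    rw [h.apply_adicInterval, h'.apply_adicInterval]

theorem ofDigits_lt_one (hℓ : 1 < ℓ) {a : ℕ → Fin ℓ} {k : ℕ}
    (hk : a k ≠ ⟨ℓ - 1, by omega⟩) : Real.ofDigits a < 1 := by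
  rw [← Real.ofDigits_const_last_eq_one' hℓ]
  refine Summable.tsum_lt_tsum (i := k) (fun i => ?_) ?_ Real.summable_ofDigitsTerm
    Real.summable_ofDigitsTerm
  · refine mul_le_mul_of_nonneg_right ?_ (by positivity)
    exact_mod_cast Nat.le_sub_one_of_lt (a i).2
  · refine mul_lt_mul_of_pos_right ?_ (by positivity)
    have h1 := (a k).2
    have h2 : (a k : ℕ) ≠ ℓ - 1 := fun e => hk (Fin.ext e)
    have h3 : (a k : ℕ) < ℓ - 1 := by omega
    exact_mod_cast h3

theorem ofDigits_mem_adicInterval (hℓ : 1 < ℓ) {a : ℕ → Fin ℓ} {n : ℕ}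
    (ha : ∃ k ≥ n, a k ≠ ⟨ℓ - 1, by omega⟩) :
    Real.ofDigits a ∈ adicInterval fun i : Fin n => a i := by
  obtain ⟨k, hk, hak⟩ := ha
  have h1 : Real.ofDigits (fun i => a (i + n)) < 1 :=
    ofDigits_lt_one hℓ (k := k - n) (by rwa [Nat.sub_add_cancel hk])
  have h0 := Real.ofDigits_nonneg (fun i => a (i + n))
  have hpos : (0 : ℝ) < ((ℓ : ℝ) ^ n)⁻¹ := by positivity
  have hsum : ∑ i ∈ Finset.range n, Real.ofDigitsTerm a i
      = ∑ i : Fin n, ((a i : ℕ) : ℝ) / (ℓ : ℝ) ^ ((i : ℕ) + 1) := by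
    rw [Finset.sum_range]
    rfl
  rw [Real.ofDigits_eq_sum_add_ofDigits a n, adicInterval, one_div, hsum, mem_Ico]
  constructor
  · have := mul_nonneg hpos.le h0
    linarith
  · have := mul_lt_mul_of_pos_left h1 hpos
    linarith

/-- The law of the number with random digits `X 0, X 1, …`. The only obstruction is the ambiguity
of expansions that end in a constant sequence of digits `ℓ - 1`. -/
theorem exists_isDrivenMeasure (hℓ : 1 < ℓ) {Ω : Type*} [MeasurableSpace Ω] {μ : Measure Ω}
    [IsProbabilityMeasure μ] {X : ℕ → Ω → Fin ℓ} (hX : ∀ n, Measurable (X n))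
    (hlast : ∀ᵐ ω ∂μ, ∀ n, ∃ k ≥ n, X k ω ≠ ⟨ℓ - 1, by omega⟩) :
    ∃ m : Measure ℝ, IsDrivenMeasure μ X m := by
  have hmeas : Measurable fun ω => Real.ofDigits fun k => X k ω :=
    Real.continuous_ofDigits.measurable.comp (measurable_pi_iff.2 hX)
  refine ⟨μ.map fun ω => Real.ofDigits fun k => X k ω,
    Measure.isProbabilityMeasure_map hmeas.aemeasurable, fun n ε => ?_⟩
  rw [Measure.map_apply hmeas (measurableSet_adicInterval ε)]
  refine measure_congr ?_
  filter_upwards [hlast] with ω hω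
  have hmem := ofDigits_mem_adicInterval hℓ (a := fun k => X k ω) (hω n)
  refine propext ⟨fun h i => ?_, fun h => ?_⟩
  · exact congrFun (eq_of_mem_adicInterval (by omega) hmem h) i
  · have : (fun i : Fin n => X i ω) = ε := funext h
    rw [this] at hmem
    exact hmem

theorem IsMarkovChain.measureReal_path_const_le {Ω : Type*} [MeasurableSpace Ω] {μ : Measure Ω}
    [IsProbabilityMeasure μ] {P : Matrix (Fin ℓ) (Fin ℓ) ℝ} {X : ℕ → Ω → Fin ℓ}
    (hX : IsMarkovChain μ P X) {s : ℕ → Fin ℓ} {a : Fin ℓ} {N : ℕ} (hs : ∀ k ≥ N, s k = a)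
    (k : ℕ) : μ.real {ω | ∀ i ≤ N + k, X i ω = s i} ≤ P a a ^ k := by
  induction k with
  | zero => simp
  | succ k ih =>
    rw [← add_assoc, hX.markov, hs (N + k) (by omega), hs (N + k + 1) (by omega), pow_succ]
    exact mul_le_mul_of_nonneg_right ih (Matrix.nonneg_of_mem_rowStochastic hX.stochastic)

/-- A Markov chain is almost surely outside a given state with `p_aa < 1` at arbitrarily late times:
the trajectories that end in a constant sequence `a` form a countable union of null sets, indexed by
the initial words. -/
theorem IsMarkovChain.ae_exists_ne {Ω : Type*} [MeasurableSpace Ω] {μ : Measure Ω}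
    [IsProbabilityMeasure μ] {P : Matrix (Fin ℓ) (Fin ℓ) ℝ} {X : ℕ → Ω → Fin ℓ}
    (hX : IsMarkovChain μ P X) {a : Fin ℓ} (ha : P a a < 1) :
    ∀ᵐ ω ∂μ, ∀ n, ∃ k ≥ n, X k ω ≠ a := by
  rw [ae_all_iff]
  intro n
  -- `ext w` is the word `w` followed by `a a a ⋯`.
  let ext : (Fin n → Fin ℓ) → ℕ → Fin ℓ := fun w k => if h : k < n then w ⟨k, h⟩ else a
  have hnull : ∀ w : Fin n → Fin ℓ, μ {ω | ∀ k, X k ω = ext w k} = 0 := by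
    intro w
    have hle : ∀ k, μ.real {ω | ∀ k, X k ω = ext w k} ≤ P a a ^ k := fun k =>
      (measureReal_mono (show {ω | ∀ k, X k ω = ext w k} ⊆ {ω | ∀ i ≤ n + k, X i ω = ext w i} from
        fun ω hω i _ => hω i)).trans
        (hX.measureReal_path_const_le (s := ext w) (N := n)
          (fun k hk => by simp [ext, hk]) k)
    have h0 := ge_of_tendsto' (tendsto_pow_atTop_nhds_zero_of_lt_one
      (Matrix.nonneg_of_mem_rowStochastic hX.stochastic) ha) hle
    exact (measureReal_eq_zero_iff).1 (le_antisymm h0 measureReal_nonneg)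
  refine measure_mono_null (fun ω hω => ?_) (measure_iUnion_null hnull)
  simp only [mem_compl_iff, mem_ofPred_eq, not_exists, not_and, not_not] at hω
  refine mem_iUnion.2 ⟨fun i => X i ω, fun k => ?_⟩
  by_cases hk : k < n
  · simp [ext, hk]
  · simpa [ext, hk] using hω k (not_lt.1 hk)

end Adic

/-! ### Partition sums of Markov measures -/

section PartitionSums

open Matrix

variable {ℓ : ℕ}

/-- The matrix `(p_ij^q)`, with the convention `0^q = 0`. -/
def powMatrix (P : Matrix (Fin ℓ) (Fin ℓ) ℝ) (q : ℝ) : Matrix (Fin ℓ) (Fin ℓ) ℝ :=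
  fun i j => if P i j = 0 then 0 else P i j ^ q

theorem powMatrix_pos_iff {P : Matrix (Fin ℓ) (Fin ℓ) ℝ} (hP : ∀ i j, 0 ≤ P i j) {q : ℝ}
    {i j : Fin ℓ} : 0 < powMatrix P q i j ↔ 0 < P i j := by
  rcases (hP i j).lt_or_eq with h | h
  · simp [powMatrix, h.ne', h, Real.rpow_pos_of_pos h]
  · simp [powMatrix, ← h]

theorem powMatrix_nonneg {P : Matrix (Fin ℓ) (Fin ℓ) ℝ} (hP : ∀ i j, 0 ≤ P i j) {q : ℝ}
    (i j : Fin ℓ) : 0 ≤ powMatrix P q i j := by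
  rw [powMatrix]
  split_ifs
  · exact le_rfl
  · exact Real.rpow_nonneg (hP i j) q

theorem powMatrix_isIrreducible {P : Matrix (Fin ℓ) (Fin ℓ) ℝ} (hP : P.IsIrreducible) (q : ℝ) :
    (powMatrix P q).IsIrreducible := by
  have h : toQuiver (powMatrix P q) = toQuiver P := by
    unfold toQuiver
    simp only [powMatrix_pos_iff hP.nonneg]
  exact ⟨powMatrix_nonneg hP.nonneg, h ▸ hP.connected⟩

theorem hasDerivAt_powMatrix {P : Matrix (Fin ℓ) (Fin ℓ) ℝ} (hP : ∀ i j, 0 ≤ P i j) (q : ℝ)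
    (i j : Fin ℓ) :
    HasDerivAt (fun t => powMatrix P t i j) (powMatrix P q i j * Real.log (P i j)) q := by
  rcases (hP i j).lt_or_eq with h | h
  · simp only [powMatrix, h.ne', if_false]
    exact (Real.hasStrictDerivAt_const_rpow h q).hasDerivAt
  · simp only [powMatrix, ← h, if_true, zero_mul]
    exact hasDerivAt_const q 0

open Classical in
/-- The contribution `m(I_ε)^q` of the word `ε` to the partition sum, with `0^q = 0`. -/
def wordWeight (m : Measure ℝ) (q : ℝ) {n : ℕ} (ε : Fin n → Fin ℓ) : ℝ :=
  if m (adicInterval ε) = 0 then 0 else m.real (adicInterval ε) ^ q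

theorem partitionSum_eq_sum_wordWeight (m : Measure ℝ) (n : ℕ) (q : ℝ) :
    partitionSum ℓ m n q = ∑ ε : Fin n → Fin ℓ, wordWeight m q ε := rfl

variable {m : Measure ℝ} {q : ℝ} {n : ℕ}

theorem wordWeight_eq_rpow [IsFiniteMeasure m] {ε : Fin n → Fin ℓ}
    (h : 0 < m.real (adicInterval ε)) : wordWeight m q ε = m.real (adicInterval ε) ^ q := by
  rw [wordWeight, if_neg]
  exact fun h0 => h.ne' ((measureReal_eq_zero_iff).2 h0)

theorem wordWeight_eq_zero [IsFiniteMeasure m] {ε : Fin n → Fin ℓ}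
    (h : m.real (adicInterval ε) = 0) : wordWeight m q ε = 0 := by
  rw [wordWeight, if_pos ((measureReal_eq_zero_iff).1 h)]

theorem wordWeight_nonneg (ε : Fin n → Fin ℓ) : 0 ≤ wordWeight m q ε := by
  rw [wordWeight]
  split_ifs
  · exact le_rfl
  · exact Real.rpow_nonneg measureReal_nonneg q

/-- The measure of a cylinder of a Markov chain, one letter at a time. -/
theorem IsDrivenMeasure.measureReal_snoc {Ω : Type*} [MeasurableSpace Ω] {μ : Measure Ω}
    {P : Matrix (Fin ℓ) (Fin ℓ) ℝ} {X : ℕ → Ω → Fin ℓ}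
    (hX : IsMarkovChain μ P X) (h : IsDrivenMeasure μ X m) (ε : Fin (n + 1) → Fin ℓ) (j : Fin ℓ) :
    m.real (adicInterval (Fin.snoc ε j : Fin (n + 2) → Fin ℓ)) =
      m.real (adicInterval ε) * P (ε (Fin.last n)) j := by
  let s : ℕ → Fin ℓ := fun k => if hk : k < n + 1 then ε ⟨k, hk⟩ else j
  have hsε : ∀ (k : ℕ) (hk : k < n + 1), s k = ε ⟨k, hk⟩ := fun k hk => dif_pos hk
  have h1 : {ω | ∀ i : Fin (n + 1), X i ω = ε i} = {ω | ∀ k ≤ n, X k ω = s k} := by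
    ext ω
    simp only [mem_ofPred_eq]
    constructor
    · intro hω k hk
      rw [hsε k (Nat.lt_succ_of_le hk)]
      exact hω ⟨k, Nat.lt_succ_of_le hk⟩
    · intro hω i
      rw [hω i (Nat.le_of_lt_succ i.2), hsε i i.2]
  have h2 : {ω | ∀ i : Fin (n + 2), X i ω = (Fin.snoc ε j : Fin (n + 2) → Fin ℓ) i} =
      {ω | ∀ k ≤ n + 1, X k ω = s k} := by
    have hs : ∀ i : Fin (n + 2), (Fin.snoc ε j : Fin (n + 2) → Fin ℓ) i = s i := by
      intro i
      refine Fin.lastCases ?_ (fun i => ?_) i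
      · simp [s]
      · rw [Fin.snoc_castSucc, Fin.val_castSucc, hsε i i.2]
    ext ω
    simp only [mem_ofPred_eq, hs]
    exact ⟨fun hω k hk => hω ⟨k, Nat.lt_succ_of_le hk⟩,
      fun hω i => hω i (Nat.le_of_lt_succ i.2)⟩
  have h3 := hX.markov n s
  rw [← h1, ← h2, measureReal_def, measureReal_def, ← h.apply_adicInterval,
    ← h.apply_adicInterval] at h3
  have h4 : s n = ε (Fin.last n) := by simp [s, Fin.last]
  have h5 : s (n + 1) = j := by simp [s]
  rw [h4, h5] at h3
  exact h3

theorem wordWeight_snoc {Ω : Type*} [MeasurableSpace Ω] {μ : Measure Ω}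
    {P : Matrix (Fin ℓ) (Fin ℓ) ℝ} {X : ℕ → Ω → Fin ℓ}
    (hX : IsMarkovChain μ P X) (h : IsDrivenMeasure μ X m) (q : ℝ) (ε : Fin (n + 1) → Fin ℓ)
    (j : Fin ℓ) : wordWeight m q (Fin.snoc ε j : Fin (n + 2) → Fin ℓ) =
      wordWeight m q ε * powMatrix P q (ε (Fin.last n)) j := by
  have := h.isProbabilityMeasure
  have hsnoc := h.measureReal_snoc hX ε j
  have hP : 0 ≤ P (ε (Fin.last n)) j := nonneg_of_mem_rowStochastic hX.stochastic
  rcases (measureReal_nonneg (μ := m) (s := adicInterval ε)).lt_or_eq with h1 | h1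
  · rcases hP.lt_or_eq with h2 | h2
    · rw [wordWeight_eq_rpow (by rw [hsnoc]; positivity), wordWeight_eq_rpow h1, hsnoc, powMatrix,
        if_neg h2.ne', Real.mul_rpow h1.le h2.le]
    · rw [wordWeight_eq_zero (by rw [hsnoc, ← h2, mul_zero]), powMatrix, if_pos h2.symm, mul_zero]
  · rw [wordWeight_eq_zero (by rw [hsnoc, ← h1, zero_mul]), wordWeight_eq_zero h1.symm, zero_mul]

theorem sum_snoc {M : Type*} [AddCommMonoid M] (f : (Fin (n + 1) → Fin ℓ) → M) :
    ∑ ε, f ε = ∑ ε : Fin n → Fin ℓ, ∑ j : Fin ℓ, f (Fin.snoc ε j) := by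
  rw [← (Fin.snocEquiv fun _ : Fin (n + 1) => Fin ℓ).sum_comp, Fintype.sum_prod_type_right]
  rfl

/-- Summing the weights against a right eigenvector of `(p_ij^q)` turns the partition sum into an
exact geometric progression. -/
theorem sum_wordWeight_mul_eigenvector {Ω : Type*} [MeasurableSpace Ω] {μ : Measure Ω}
    {P : Matrix (Fin ℓ) (Fin ℓ) ℝ} {X : ℕ → Ω → Fin ℓ}
    (hX : IsMarkovChain μ P X) (h : IsDrivenMeasure μ X m) {r : ℝ} {v : Fin ℓ → ℝ}
    (hv : powMatrix P q *ᵥ v = r • v) (n : ℕ) :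
    ∑ ε : Fin (n + 1) → Fin ℓ, wordWeight m q ε * v (ε (Fin.last n)) =
      r ^ n * ∑ ε : Fin 1 → Fin ℓ, wordWeight m q ε * v (ε (Fin.last 0)) := by
  induction n with
  | zero => simp
  | succ n ih =>
    rw [sum_snoc, pow_succ', mul_assoc, ← ih, Finset.mul_sum]
    refine Finset.sum_congr rfl fun ε _ => ?_
    have hrow := congrFun hv (ε (Fin.last n))
    simp only [mulVec, dotProduct, Pi.smul_apply, smul_eq_mul] at hrow
    simp only [wordWeight_snoc hX h, Fin.snoc_last, mul_assoc]
    rw [← Finset.mul_sum, hrow]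
    ring

theorem exists_letter_pos (hℓ : 0 < ℓ) [IsProbabilityMeasure m] (hm : m (Ico 0 1)ᶜ = 0) :
    ∃ ε : Fin 1 → Fin ℓ, 0 < m.real (adicInterval ε) := by
  by_contra! hcon
  have h1 : m (⋃ ε : Fin 1 → Fin ℓ, adicInterval ε) = 0 := measure_iUnion_null fun ε =>
    (measureReal_eq_zero_iff).1 (le_antisymm (hcon ε) measureReal_nonneg)
  rw [iUnion_adicInterval hℓ, (prob_compl_eq_zero_iff measurableSet_Ico).1 hm] at h1
  exact one_ne_zero h1

/-- Partition sums are comparable to the powers of the Perron root, because a positive eigenvector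
is bounded above and away from zero. -/
theorem partitionSum_bounds (hℓ : 0 < ℓ) {Ω : Type*} [MeasurableSpace Ω] {μ : Measure Ω}
    [IsProbabilityMeasure μ] {P : Matrix (Fin ℓ) (Fin ℓ) ℝ} {X : ℕ → Ω → Fin ℓ}
    (hX : IsMarkovChain μ P X) (h : IsDrivenMeasure μ X m) {r : ℝ} (hr : 0 < r) {v : Fin ℓ → ℝ}
    (hvpos : ∀ i, 0 < v i) (hv : powMatrix P q *ᵥ v = r • v) :
    ∃ c C : ℝ, 0 < c ∧ 0 < C ∧ ∀ n, c * r ^ n ≤ partitionSum ℓ m n q ∧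
      partitionSum ℓ m n q ≤ C * r ^ n := by
  have := h.isProbabilityMeasure
  have : Nonempty (Fin ℓ) := ⟨⟨0, hℓ⟩⟩
  obtain ⟨i₁, hi₁⟩ := Finite.exists_max v
  obtain ⟨i₀, hi₀⟩ := Finite.exists_min v
  set S := ∑ ε : Fin 1 → Fin ℓ, wordWeight m q ε * v (ε (Fin.last 0)) with hS
  have hSpos : 0 < S := by
    obtain ⟨ε, hε⟩ := exists_letter_pos (ℓ := ℓ) hℓ h.compl_Ico
    refine Finset.sum_pos' (fun ε _ => mul_nonneg (wordWeight_nonneg ε) (hvpos _).le)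
      ⟨ε, Finset.mem_univ ε, mul_pos ?_ (hvpos _)⟩
    rw [wordWeight_eq_rpow hε]
    exact Real.rpow_pos_of_pos hε q
  have hsucc : ∀ n, S / (v i₁ * r) * r ^ (n + 1) ≤ partitionSum ℓ m (n + 1) q ∧
      partitionSum ℓ m (n + 1) q ≤ S / (v i₀ * r) * r ^ (n + 1) := by
    intro n
    have hsum := sum_wordWeight_mul_eigenvector hX h hv n
    rw [← hS] at hsum
    have e1 : ∀ x : ℝ, 0 < x → S / (x * r) * r ^ (n + 1) = r ^ n * S / x := by
      intro x hx
      rw [pow_succ]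
      field_simp
    rw [e1 _ (hvpos i₁), e1 _ (hvpos i₀), ← hsum, partitionSum_eq_sum_wordWeight,
      div_le_iff₀ (hvpos i₁), le_div_iff₀ (hvpos i₀), Finset.sum_mul, Finset.sum_mul]
    exact ⟨Finset.sum_le_sum fun ε _ => mul_le_mul_of_nonneg_left (hi₁ _) (wordWeight_nonneg ε),
      Finset.sum_le_sum fun ε _ => mul_le_mul_of_nonneg_left (hi₀ _) (wordWeight_nonneg ε)⟩
  have hzero : partitionSum ℓ m 0 q = 1 := by
    have h1 : m.real (Ico 0 1) = 1 := by
      rw [measureReal_def, (prob_compl_eq_zero_iff measurableSet_Ico).1 h.compl_Ico]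
      simp
    rw [partitionSum_eq_sum_wordWeight, Fintype.sum_unique, wordWeight_eq_rpow]
    · rw [adicInterval_zero, h1, Real.one_rpow]
    · rw [adicInterval_zero, h1]
      exact one_pos
  have hc : 0 < S / (v i₁ * r) := div_pos hSpos (mul_pos (hvpos _) hr)
  have hC : 0 < S / (v i₀ * r) := div_pos hSpos (mul_pos (hvpos _) hr)
  refine ⟨min 1 (S / (v i₁ * r)), max 1 (S / (v i₀ * r)), lt_min one_pos hc,
    lt_max_of_lt_left one_pos, fun n => ?_⟩
  cases n with
  | zero => rw [hzero, pow_zero, mul_one, mul_one]; exact ⟨min_le_left _ _, le_max_left _ _⟩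
  | succ n =>
    exact ⟨(mul_le_mul_of_nonneg_right (min_le_right _ _) (by positivity)).trans (hsucc n).1,
      (hsucc n).2.trans (mul_le_mul_of_nonneg_right (le_max_right _ _) (by positivity))⟩

theorem tendsto_log_partitionSum (hℓ : 1 < ℓ) {r c C : ℝ} (hr : 0 < r) (hc : 0 < c) (hC : 0 < C)
    (h : ∀ n, c * r ^ n ≤ partitionSum ℓ m n q ∧ partitionSum ℓ m n q ≤ C * r ^ n) :
    Tendsto (fun n : ℕ => 1 / ((n : ℝ) * Real.log ℓ) * Real.log (partitionSum ℓ m n q)) atTop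
      (𝓝 (Real.log r / Real.log ℓ)) := by
  have hL : 0 < Real.log ℓ := Real.log_pos (by exact_mod_cast hℓ)
  have hlim : ∀ a : ℝ, Tendsto
      (fun n : ℕ => 1 / ((n : ℝ) * Real.log ℓ) * (Real.log a + n * Real.log r)) atTop
      (𝓝 (Real.log r / Real.log ℓ)) := by
    intro a
    have h1 : Tendsto (fun n : ℕ => Real.log a / Real.log ℓ * ((n : ℝ))⁻¹ + Real.log r / Real.log ℓ)
        atTop (𝓝 (Real.log a / Real.log ℓ * 0 + Real.log r / Real.log ℓ)) :=
      (tendsto_inv_atTop_nhds_zero_nat.const_mul _).add_const _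
    rw [mul_zero, zero_add] at h1
    refine h1.congr' ?_
    filter_upwards [eventually_gt_atTop 0] with n hn
    field_simp
  refine tendsto_of_tendsto_of_tendsto_of_le_of_le (hlim c) (hlim C) (fun n => ?_) (fun n => ?_)
  · refine mul_le_mul_of_nonneg_left ?_ (by positivity)
    rw [← Real.log_pow, ← Real.log_mul hc.ne' (by positivity)]
    exact Real.log_le_log (by positivity) (h n).1
  · refine mul_le_mul_of_nonneg_left ?_ (by positivity)
    rw [← Real.log_pow, ← Real.log_mul hC.ne' (by positivity)]
    exact Real.log_le_log ((by positivity : 0 < c * r ^ n).trans_le (h n).1) (h n).2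

/-- Hölder's inequality for partition sums, obtained from the weighted inequality of arithmetic and
geometric means applied to the normalized weights. -/
theorem partitionSum_convex_combination_le [IsFiniteMeasure m] {q₁ q₂ a b : ℝ} (ha : 0 ≤ a)
    (hb : 0 ≤ b) (hab : a + b = 1) (h₁ : 0 < partitionSum ℓ m n q₁)
    (h₂ : 0 < partitionSum ℓ m n q₂) :
    partitionSum ℓ m n (a * q₁ + b * q₂) ≤
      partitionSum ℓ m n q₁ ^ a * partitionSum ℓ m n q₂ ^ b := by
  set Z₁ := partitionSum ℓ m n q₁ with hZ₁
  set Z₂ := partitionSum ℓ m n q₂ with hZ₂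
  have hterm : ∀ ε : Fin n → Fin ℓ, wordWeight m (a * q₁ + b * q₂) ε ≤
      Z₁ ^ a * Z₂ ^ b * (a * (wordWeight m q₁ ε / Z₁) + b * (wordWeight m q₂ ε / Z₂)) := by
    intro ε
    rcases (measureReal_nonneg (μ := m) (s := adicInterval ε)).lt_or_eq with h | h
    · have hw₁ := wordWeight_nonneg (m := m) (q := q₁) ε
      have hw₂ := wordWeight_nonneg (m := m) (q := q₂) ε
      have hamgm := Real.geom_mean_le_arith_mean2_weighted ha hb (div_nonneg hw₁ h₁.le)
        (div_nonneg hw₂ h₂.le) hab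
      refine le_trans (le_of_eq ?_) (mul_le_mul_of_nonneg_left hamgm (by positivity))
      have hZa : Z₁ ^ a ≠ 0 := (Real.rpow_pos_of_pos h₁ a).ne'
      have hZb : Z₂ ^ b ≠ 0 := (Real.rpow_pos_of_pos h₂ b).ne'
      rw [Real.div_rpow hw₁ h₁.le, Real.div_rpow hw₂ h₂.le, wordWeight_eq_rpow h,
        wordWeight_eq_rpow h, wordWeight_eq_rpow h, ← Real.rpow_mul h.le, ← Real.rpow_mul h.le,
        mul_comm q₁, mul_comm q₂, Real.rpow_add h]
      field_simp
    · rw [wordWeight_eq_zero h.symm, wordWeight_eq_zero h.symm, wordWeight_eq_zero h.symm]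
      simp
  calc partitionSum ℓ m n (a * q₁ + b * q₂)
      ≤ ∑ ε : Fin n → Fin ℓ, Z₁ ^ a * Z₂ ^ b *
          (a * (wordWeight m q₁ ε / Z₁) + b * (wordWeight m q₂ ε / Z₂)) :=
        Finset.sum_le_sum fun ε _ => hterm ε
    _ = Z₁ ^ a * Z₂ ^ b * (a * (Z₁ / Z₁) + b * (Z₂ / Z₂)) := by
        rw [← Finset.mul_sum, Finset.sum_add_distrib, ← Finset.mul_sum, ← Finset.mul_sum,
          ← Finset.sum_div, ← Finset.sum_div]
        rfl
    _ = Z₁ ^ a * Z₂ ^ b := by rw [div_self h₁.ne', div_self h₂.ne', mul_one, mul_one, hab, mul_one]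

end PartitionSums

/-! ### Gibbs measures -/

section Gibbs

open Matrix

variable {ℓ : ℕ}

/-- The probability measure on the alphabet given by a row of a stochastic matrix. -/
def rowMeasure (Q : Matrix (Fin ℓ) (Fin ℓ) ℝ) (i : Fin ℓ) : Measure (Fin ℓ) :=
  ∑ j, ENNReal.ofReal (Q i j) • Measure.dirac j

theorem rowMeasure_singleton (Q : Matrix (Fin ℓ) (Fin ℓ) ℝ) (i j : Fin ℓ) :
    rowMeasure Q i {j} = ENNReal.ofReal (Q i j) := by
  simp [rowMeasure, Measure.finsetSum_apply, Set.indicator_apply]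

theorem isProbabilityMeasure_rowMeasure {Q : Matrix (Fin ℓ) (Fin ℓ) ℝ}
    (hQ : Q ∈ rowStochastic ℝ (Fin ℓ)) (i : Fin ℓ) : IsProbabilityMeasure (rowMeasure Q i) := by
  constructor
  simp only [rowMeasure, Measure.finsetSum_apply, Measure.smul_apply, measure_univ, smul_eq_mul,
    mul_one]
  rw [← ENNReal.ofReal_sum_of_nonneg fun j _ => nonneg_of_mem_rowStochastic hQ,
    sum_row_of_mem_rowStochastic hQ, ENNReal.ofReal_one]

/-- The trajectory issued from `i₀` that jumps at time `n` from the state `i` to the state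
`ω (n, i)`. -/
def trajectory (i₀ : Fin ℓ) : ℕ → (ℕ × Fin ℓ → Fin ℓ) → Fin ℓ
  | 0, _ => i₀
  | n + 1, ω => ω (n, trajectory i₀ n ω)

theorem measurable_trajectory (i₀ : Fin ℓ) (n : ℕ) : Measurable (trajectory i₀ n) := by
  induction n with
  | zero => exact measurable_const
  | succ n ih =>
    refine measurable_to_countable' fun x => ?_
    have : trajectory i₀ (n + 1) ⁻¹' {x} =
        ⋃ i, trajectory i₀ n ⁻¹' {i} ∩ (fun ω : ℕ × Fin ℓ → Fin ℓ => ω (n, i)) ⁻¹' {x} := by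
      ext ω
      simp [trajectory]
    rw [this]
    exact MeasurableSet.iUnion fun i => (ih (measurableSet_singleton i)).inter
      (measurable_pi_apply _ (measurableSet_singleton x))

/-- Markov chains with a prescribed transition matrix and a deterministic initial state exist: jump
according to independent random maps of the alphabet. -/
theorem exists_isMarkovChain {Q : Matrix (Fin ℓ) (Fin ℓ) ℝ} (hQ : Q ∈ rowStochastic ℝ (Fin ℓ))
    (i₀ : Fin ℓ) : ∃ μ : Measure (ℕ × Fin ℓ → Fin ℓ), IsProbabilityMeasure μ ∧
      IsMarkovChain μ Q (trajectory i₀) := by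
  have := fun p : ℕ × Fin ℓ => isProbabilityMeasure_rowMeasure hQ p.2
  refine ⟨Measure.infinitePi fun p : ℕ × Fin ℓ => rowMeasure Q p.2, inferInstance,
    measurable_trajectory i₀, hQ, fun n s => ?_⟩
  by_cases hs : s 0 = i₀
  · have hset : ∀ n, {ω | ∀ k ≤ n, trajectory i₀ k ω = s k} =
        Set.pi ((Finset.range n).image fun k => (k, s k)) fun p => {s (p.1 + 1)} := by
      intro n
      ext ω
      simp only [mem_ofPred_eq, Set.mem_pi, Finset.coe_image, Finset.coe_range, mem_image, mem_Iio,
        mem_singleton_iff, forall_exists_index, and_imp, forall_apply_eq_imp_iff₂]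
      constructor
      · intro h k hk
        rw [← h (k + 1) hk, trajectory, h k hk.le]
      · intro h k hk
        induction k with
        | zero => exact hs.symm
        | succ k ih => rw [trajectory, ih (by omega), h k hk]
    have hprob : ∀ n, (Measure.infinitePi fun p : ℕ × Fin ℓ => rowMeasure Q p.2)
        {ω | ∀ k ≤ n, trajectory i₀ k ω = s k} =
        ∏ k ∈ Finset.range n, ENNReal.ofReal (Q (s k) (s (k + 1))) := by
      intro n
      rw [hset, Measure.infinitePi_pi _ (fun p _ => measurableSet_singleton _),
        Finset.prod_image fun a _ b _ hab => (Prod.ext_iff.1 hab).1]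
      simp only [rowMeasure_singleton]
    rw [measureReal_def, measureReal_def, hprob, hprob, Finset.prod_range_succ, ENNReal.toReal_mul,
      ENNReal.toReal_ofReal (nonneg_of_mem_rowStochastic hQ)]
  · have hempty : ∀ n, {ω | ∀ k ≤ n, trajectory i₀ k ω = s k} = ∅ := fun n =>
      eq_empty_of_forall_notMem fun ω hω => hs (hω 0 (Nat.zero_le n)).symm
    rw [hempty, hempty]
    simp

/-- For every `q` there is a Gibbs measure for the potential `q log p_ij`: a probability measure
dominated on the `ℓ`-adic intervals of order `n` by a multiple of `m(I)^q r^{-n}`, where `r` is the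
Perron root of `(p_ij^q)`. It is driven by the chain with transitions `p_ij^q v_j / (r v_i)`. -/
theorem exists_gibbs_measure (hℓ : 1 < ℓ) {Ω : Type*} [MeasurableSpace Ω] {μ : Measure Ω}
    [IsProbabilityMeasure μ] {P : Matrix (Fin ℓ) (Fin ℓ) ℝ} {X : ℕ → Ω → Fin ℓ}
    (hX : IsMarkovChain μ P X) (hne : ∀ i j, P i j ≠ 1) {m : Measure ℝ}
    (h : IsDrivenMeasure μ X m) {q r : ℝ} (hr : 0 < r) {v : Fin ℓ → ℝ}
    (hvpos : ∀ i, 0 < v i) (hv : powMatrix P q *ᵥ v = r • v) :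
    ∃ ν : Measure ℝ, IsProbabilityMeasure ν ∧ ν (Ico 0 1)ᶜ = 0 ∧ ∃ C : ℝ, 0 < C ∧
      ∀ (n : ℕ) (ε : Fin n → Fin ℓ),
        ν.real (adicInterval ε) ≤ C * wordWeight m q ε * (r ^ n)⁻¹ := by
  have := h.isProbabilityMeasure
  have hP : ∀ i j, 0 ≤ P i j := fun i j => nonneg_of_mem_rowStochastic hX.stochastic
  have hA : ∀ i j, 0 ≤ powMatrix P q i j := powMatrix_nonneg hP
  let Q : Matrix (Fin ℓ) (Fin ℓ) ℝ := fun i j => powMatrix P q i j * v j / (r * v i)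
  have hQ : Q ∈ rowStochastic ℝ (Fin ℓ) := by
    refine mem_rowStochastic_iff_sum.2 ⟨fun i j => ?_, fun i => ?_⟩
    · exact div_nonneg (mul_nonneg (hA i j) (hvpos j).le) (mul_pos hr (hvpos i)).le
    · have hrow := congrFun hv i
      simp only [mulVec, dotProduct, Pi.smul_apply, smul_eq_mul] at hrow
      simp only [Q]
      rw [← Finset.sum_div, hrow, div_self (mul_pos hr (hvpos i)).ne']
  -- A state absorbing for `Q` would be absorbing for `P`, since both have the same zero entries.
  have hQ1 : ∀ a, Q a a < 1 := by
    intro a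
    refine lt_of_le_of_ne (le_one_of_mem_rowStochastic hQ) fun h1 => hne a a ?_
    have hsum := sum_row_of_mem_rowStochastic hQ a
    rw [← Finset.add_sum_erase _ _ (Finset.mem_univ a), h1, add_eq_left,
      Finset.sum_eq_zero_iff_of_nonneg fun j _ => nonneg_of_mem_rowStochastic hQ] at hsum
    have hsumP := sum_row_of_mem_rowStochastic hX.stochastic a
    rw [← Finset.add_sum_erase _ _ (Finset.mem_univ a), Finset.sum_eq_zero fun j hj => ?_,
      add_zero] at hsumP
    · exact hsumP
    · by_contra hcon
      have hpos := (powMatrix_pos_iff (q := q) hP).2 (lt_of_le_of_ne (hP a j) (Ne.symm hcon))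
      exact (div_pos (mul_pos hpos (hvpos j)) (mul_pos hr (hvpos a))).ne' (hsum j hj)
  obtain ⟨ε₀, hε₀⟩ := exists_letter_pos (ℓ := ℓ) (by omega) h.compl_Ico
  obtain ⟨ρ, hρ, hchain⟩ := exists_isMarkovChain hQ (ε₀ 0)
  obtain ⟨ν, hν⟩ := exists_isDrivenMeasure hℓ hchain.measurable (hchain.ae_exists_ne (hQ1 _))
  have := hν.isProbabilityMeasure
  refine ⟨ν, hν.isProbabilityMeasure, hν.compl_Ico, ?_⟩
  have hw₀ : 0 < wordWeight m q ε₀ := by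
    rw [wordWeight_eq_rpow hε₀]
    exact Real.rpow_pos_of_pos hε₀ q
  obtain ⟨i₁, hi₁⟩ : ∃ i, ∀ j, v j ≤ v i :=
    have : Nonempty (Fin ℓ) := ⟨ε₀ 0⟩
    Finite.exists_max v
  set K := (wordWeight m q ε₀ * v (ε₀ 0))⁻¹ with hK
  have hKpos : 0 < K := inv_pos.2 (mul_pos hw₀ (hvpos _))
  have hstep : ∀ (n : ℕ) (ε : Fin (n + 1) → Fin ℓ), ν.real (adicInterval ε) ≤
      K * wordWeight m q ε * (r ^ n)⁻¹ * v (ε (Fin.last n)) := by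
    intro n
    induction n with
    | zero =>
      intro ε
      by_cases hε : ε 0 = ε₀ 0
      · have : ε = ε₀ := funext fun i => by rw [Fin.fin_one_eq_zero i, hε]
        subst this
        refine measureReal_le_one.trans (le_of_eq ?_)
        rw [hK, pow_zero, inv_one, mul_one, mul_assoc]
        exact (inv_mul_cancel₀ (mul_pos hw₀ (hvpos _)).ne').symm
      · have h0 : ν.real (adicInterval ε) = 0 := by
          rw [measureReal_def, hν.apply_adicInterval]
          have : {ω | ∀ i : Fin (0 + 1), trajectory (ε₀ 0) i ω = ε i} = ∅ :=
            eq_empty_of_forall_notMem fun ω hω => hε (hω 0).symm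
          rw [this, measure_empty, ENNReal.toReal_zero]
        rw [h0]
        have := wordWeight_nonneg (m := m) (q := q) ε
        have := hvpos (ε (Fin.last 0))
        positivity
    | succ n ih =>
      intro ε
      obtain ⟨δ, j, rfl⟩ : ∃ (δ : Fin (n + 1) → Fin ℓ) (j : Fin ℓ), ε = Fin.snoc δ j :=
        ⟨Fin.init ε, ε (Fin.last _), (Fin.snoc_init_self ε).symm⟩
      rw [hν.measureReal_snoc hchain, wordWeight_snoc hX h, Fin.snoc_last]
      refine (mul_le_mul_of_nonneg_right (ih δ) (nonneg_of_mem_rowStochastic hQ)).trans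
        (le_of_eq ?_)
      have := (hvpos (δ (Fin.last n))).ne'
      simp only [Q, pow_succ]
      field_simp
  refine ⟨max 1 (K * r * v i₁), lt_max_of_lt_left one_pos, fun n ε => ?_⟩
  cases n with
  | zero =>
    have h1 : m.real (adicInterval ε) = 1 := by
      rw [adicInterval_zero, measureReal_def,
        (prob_compl_eq_zero_iff measurableSet_Ico).1 h.compl_Ico]
      simp
    rw [wordWeight_eq_rpow (by rw [h1]; exact one_pos), h1]
    refine measureReal_le_one.trans ?_
    simp
  | succ n =>
    have hw := wordWeight_nonneg (m := m) (q := q) ε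
    calc ν.real (adicInterval ε)
        ≤ K * wordWeight m q ε * (r ^ n)⁻¹ * v (ε (Fin.last n)) := hstep n ε
      _ ≤ K * wordWeight m q ε * (r ^ n)⁻¹ * v i₁ :=
          mul_le_mul_of_nonneg_left (hi₁ _) (by positivity)
      _ = K * r * v i₁ * wordWeight m q ε * (r ^ (n + 1))⁻¹ := by
          rw [pow_succ]
          field_simp
      _ ≤ _ := mul_le_mul_of_nonneg_right
          (mul_le_mul_of_nonneg_right (le_max_right _ _) hw) (by positivity)

end Gibbs

/-! ### Cells and level sets -/

section Cells

variable {ℓ : ℕ}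

theorem log_volume_adicCell (hℓ : 0 < ℓ) (n : ℕ) (x : ℝ) :
    Real.log (volume.real (adicCell ℓ n x)) = -(n * Real.log ℓ) := by
  have hpos : (0 : ℝ) < (ℓ : ℝ) ^ n := by positivity
  rw [adicCell, Real.volume_real_Ico_of_le (by gcongr; linarith), ← sub_div, add_sub_cancel_left,
    one_div, Real.log_inv, Real.log_pow]

theorem exp_neg_mul_log_eq (hℓ : 0 < ℓ) (n : ℕ) :
    Real.exp (-(n * Real.log ℓ)) = ((ℓ : ℝ) ^ n)⁻¹ := by
  rw [Real.exp_neg, Real.exp_nat_mul, Real.exp_log (by exact_mod_cast hℓ)]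

theorem mem_adicCell (hℓ : 0 < ℓ) (n : ℕ) (x : ℝ) : x ∈ adicCell ℓ n x := by
  have hpos : (0 : ℝ) < (ℓ : ℝ) ^ n := by positivity
  rw [adicCell, mem_Ico, div_le_iff₀ hpos, lt_div_iff₀ hpos, mul_comm x]
  exact ⟨Int.floor_le _, Int.lt_floor_add_one _⟩

theorem measurable_measureReal_adicCell (m : Measure ℝ) (n : ℕ) :
    Measurable fun x => m.real (adicCell ℓ n x) :=
  (measurable_from_top (f := fun z : ℤ =>
    m.real (Ico ((z : ℝ) / (ℓ : ℝ) ^ n) (((z : ℝ) + 1) / (ℓ : ℝ) ^ n)))).comp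
    (Int.measurable_floor.comp (measurable_const_mul _))

/-- Membership in the level set in terms of the real masses of the cells. -/
theorem mem_levelSet_iff (hℓ : 0 < ℓ) {m : Measure ℝ} [IsFiniteMeasure m] {α x : ℝ} :
    x ∈ levelSet ℓ m α ↔ x ∈ Ico (0 : ℝ) 1 ∧ (∀ n : ℕ, 0 < m.real (adicCell ℓ n x)) ∧
      Tendsto (fun n : ℕ => Real.log (m.real (adicCell ℓ n x)) / -(n * Real.log ℓ)) atTop
        (𝓝 α) := by
  have h : ∀ n : ℕ, 0 < m (adicCell ℓ n x) ↔ 0 < m.real (adicCell ℓ n x) := fun n => by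
    rw [measureReal_def, ENNReal.toReal_pos_iff]
    exact ⟨fun h => ⟨h, measure_lt_top _ _⟩, And.left⟩
  simp only [levelSet, mem_ofPred_eq, log_volume_adicCell hℓ, h]

theorem ediam_le_of_subset_adicInterval (hℓ : 0 < ℓ) {n : ℕ} {ε : Fin n → Fin ℓ} {s : Set ℝ}
    (hs : s ⊆ adicInterval ε) :
    Metric.ediam s ≤ ENNReal.ofReal (Real.exp (-(n * Real.log ℓ))) := by
  rw [exp_neg_mul_log_eq hℓ]
  refine Metric.ediam_le fun x hx y hy => ?_
  rw [edist_dist]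
  exact ENNReal.ofReal_le_ofReal (abs_sub_le_of_mem_adicInterval (hs hx) (hs hy))

theorem tendsto_exp_neg_mul_log (hℓ : 1 < ℓ) :
    Tendsto (fun n : ℕ => Real.exp (-(n * Real.log ℓ))) atTop (𝓝 0) := by
  have hL : 0 < Real.log ℓ := Real.log_pos (by exact_mod_cast hℓ)
  exact Real.tendsto_exp_neg_atTop_nhds_zero.comp
    (tendsto_natCast_atTop_atTop.atTop_mul_const hL)

end Cells

/-! ### Upper bound for the dimension of level sets -/

section UpperBound

variable {ℓ : ℕ} {m : Measure ℝ} {α q T C : ℝ}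

/-- A point of the level set contributes `ℓ^{-nαq}` to the partition sum, up to subexponential
factors, so that `αq + τ(q)` cannot be negative if the level set is nonempty. -/
theorem legendre_nonneg_of_mem_levelSet (hℓ : 1 < ℓ) [IsFiniteMeasure m] {x : ℝ}
    (hx : x ∈ levelSet ℓ m α)
    (hZ : ∀ n : ℕ, partitionSum ℓ m n q ≤ C * Real.exp (n * (Real.log ℓ * T))) :
    0 ≤ α * q + T := by
  have hL : 0 < Real.log ℓ := Real.log_pos (by exact_mod_cast hℓ)
  obtain ⟨hx01, hpos, hlim⟩ := (mem_levelSet_iff (by omega)).1 hx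
  have hle : ∀ n : ℕ, m.real (adicCell ℓ n x) ^ q ≤ C * Real.exp (n * (Real.log ℓ * T)) := by
    intro n
    obtain ⟨ε, -, hε⟩ := exists_adicInterval_eq_adicCell (by omega : 0 < ℓ) n hx01
    refine le_trans ?_ (hZ n)
    have hp := hpos n
    rw [hε] at hp ⊢
    rw [← wordWeight_eq_rpow hp, partitionSum_eq_sum_wordWeight]
    exact Finset.single_le_sum (f := fun ε : Fin n → Fin ℓ => wordWeight m q ε)
      (fun ε _ => wordWeight_nonneg ε) (Finset.mem_univ ε)
  have hC : 0 < C := by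
    have h0 := (Real.rpow_pos_of_pos (hpos 0) q).trans_le (hle 0)
    simpa using h0
  have h1 : Tendsto (fun n : ℕ => Real.log (m.real (adicCell ℓ n x)) / -(n * Real.log ℓ) * q +
      Real.log C / Real.log ℓ * (n : ℝ)⁻¹ + T) atTop
      (𝓝 (α * q + Real.log C / Real.log ℓ * 0 + T)) :=
    ((hlim.mul_const q).add (tendsto_inv_atTop_nhds_zero_nat.const_mul _)).add_const T
  rw [mul_zero, add_zero] at h1
  refine ge_of_tendsto h1 ?_
  filter_upwards [eventually_gt_atTop 0] with n hn
  have hn' : (0 : ℝ) < n := by exact_mod_cast hn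
  have h2 := Real.log_le_log (Real.rpow_pos_of_pos (hpos n) q) (hle n)
  rw [Real.log_rpow (hpos n), Real.log_mul hC.ne' (Real.exp_pos _).ne', Real.log_exp] at h2
  have h3 : Real.log (m.real (adicCell ℓ n x)) / -(n * Real.log ℓ) * q +
      Real.log C / Real.log ℓ * (n : ℝ)⁻¹ + T =
      (Real.log C + n * (Real.log ℓ * T) - q * Real.log (m.real (adicCell ℓ n x))) /
        (n * Real.log ℓ) := by
    field_simp
    ring
  rw [h3]
  exact div_nonneg (by linarith) (by positivity)

/-- The points all of whose cells of order at least `N` have `m(I)^q ≥ ℓ^{-nβ}` are covered, at each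
order `n`, by at most `ℓ^{nβ} ∑ m(I)^q` cells. -/
theorem dimH_le_of_cell_rpow_ge (hℓ : 1 < ℓ) [IsFiniteMeasure m]
    (hZ : ∀ n : ℕ, partitionSum ℓ m n q ≤ C * Real.exp (n * (Real.log ℓ * T))) {β : ℝ}
    (hβ : 0 < β + T) (N : ℕ) :
    dimH {x | x ∈ Ico (0 : ℝ) 1 ∧ ∀ n ≥ N, 0 < m.real (adicCell ℓ n x) ∧
      Real.exp (-(n * (Real.log ℓ * β))) ≤ m.real (adicCell ℓ n x) ^ q} ≤
      ENNReal.ofReal (β + T) := by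
  set A := {x | x ∈ Ico (0 : ℝ) 1 ∧ ∀ n ≥ N, 0 < m.real (adicCell ℓ n x) ∧
      Real.exp (-(n * (Real.log ℓ * β))) ≤ m.real (adicCell ℓ n x) ^ q} with hA
  refine dimH_le_of_hausdorffMeasure_ne_top (d := (β + T).toNNReal) ?_
  rw [Real.coe_toNNReal _ hβ.le]
  refine ne_top_of_le_ne_top (ENNReal.ofReal_ne_top (r := C)) ?_
  have hr : Tendsto (fun n : ℕ => ENNReal.ofReal (Real.exp (-(n * Real.log ℓ)))) atTop (𝓝 0) := by
    rw [← ENNReal.ofReal_zero]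
    exact ENNReal.tendsto_ofReal (tendsto_exp_neg_mul_log hℓ)
  refine (Measure.hausdorffMeasure_le_liminf_sum (ι := fun n : ℕ => Fin n → Fin ℓ) (β + T) A _ hr
    (fun n ε => adicInterval ε ∩ A)
    (Eventually.of_forall fun n ε => ediam_le_of_subset_adicInterval (by omega) inter_subset_left)
    (Eventually.of_forall fun n x hx => ?_)).trans ?_
  · obtain ⟨ε, hε⟩ := exists_mem_adicInterval (by omega : 0 < ℓ) n hx.1
    exact mem_iUnion.2 ⟨ε, hε, hx⟩
  refine liminf_le_of_frequently_le' (Eventually.frequently ?_)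
  filter_upwards [eventually_ge_atTop N] with n hn
  have hterm : ∀ ε : Fin n → Fin ℓ, Metric.ediam (adicInterval ε ∩ A) ^ (β + T) ≤
      ENNReal.ofReal (wordWeight m q ε * Real.exp (-(n * (Real.log ℓ * T)))) := by
    intro ε
    rcases (adicInterval ε ∩ A).eq_empty_or_nonempty with he | ⟨x, hxε, hxA⟩
    · rw [he, Metric.ediam_empty, ENNReal.zero_rpow_of_pos hβ]
      exact zero_le
    · obtain ⟨hp, hge⟩ := hxA.2 n hn
      rw [adicCell_eq_adicInterval (by omega) ε hxε] at hp hge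
      refine (ENNReal.rpow_le_rpow (ediam_le_of_subset_adicInterval (by omega)
        inter_subset_left) hβ.le).trans ?_
      rw [ENNReal.ofReal_rpow_of_nonneg (Real.exp_pos _).le hβ.le, ← Real.exp_mul,
        wordWeight_eq_rpow hp]
      refine ENNReal.ofReal_le_ofReal ?_
      refine le_trans (le_of_eq ?_) (mul_le_mul_of_nonneg_right hge (Real.exp_pos _).le)
      rw [← Real.exp_add]
      ring_nf
  refine (Finset.sum_le_sum fun ε _ => hterm ε).trans ?_
  rw [← ENNReal.ofReal_sum_of_nonneg
    fun ε _ => mul_nonneg (wordWeight_nonneg ε) (Real.exp_pos _).le, ← Finset.sum_mul,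
    ← partitionSum_eq_sum_wordWeight]
  refine ENNReal.ofReal_le_ofReal ((mul_le_mul_of_nonneg_right (hZ n) (Real.exp_pos _).le).trans
    (le_of_eq ?_))
  rw [mul_assoc, ← Real.exp_add, add_neg_cancel, Real.exp_zero, mul_one]

/-- The upper bound in the multifractal formalism, valid for every `q`. The exponent is raised by
`δ` to absorb the subexponential error in `m(I_n(x)) ≈ ℓ^{-nα}`. -/
theorem dimH_levelSet_le (hℓ : 1 < ℓ) [IsFiniteMeasure m]
    (hZ : ∀ n : ℕ, partitionSum ℓ m n q ≤ C * Real.exp (n * (Real.log ℓ * T)))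
    (h0 : 0 ≤ α * q + T) :
    dimH (levelSet ℓ m α) ≤ ENNReal.ofReal (α * q + T) := by
  have hL : 0 < Real.log ℓ := Real.log_pos (by exact_mod_cast hℓ)
  have key : ∀ δ > 0, dimH (levelSet ℓ m α) ≤ ENNReal.ofReal (α * q + δ + T) := by
    intro δ hδ
    have hsub : levelSet ℓ m α ⊆ ⋃ N : ℕ, {x | x ∈ Ico (0 : ℝ) 1 ∧ ∀ n ≥ N,
        0 < m.real (adicCell ℓ n x) ∧
        Real.exp (-(n * (Real.log ℓ * (α * q + δ)))) ≤ m.real (adicCell ℓ n x) ^ q} := by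
      intro x hx
      obtain ⟨hx01, hpos, hlim⟩ := (mem_levelSet_iff (by omega)).1 hx
      have h1 := (hlim.mul_const q).eventually_lt_const (show α * q < α * q + δ by linarith)
      obtain ⟨N, hN⟩ := eventually_atTop.1 (h1.and (eventually_gt_atTop 0))
      refine mem_iUnion.2 ⟨N, hx01, fun n hn => ⟨hpos n, ?_⟩⟩
      obtain ⟨h2, h3⟩ := hN n hn
      have hn' : (0 : ℝ) < n := by exact_mod_cast h3
      rw [Real.rpow_def_of_pos (hpos n), Real.exp_le_exp]
      rw [div_neg, neg_mul, div_mul_eq_mul_div, ← neg_div, div_lt_iff₀ (by positivity)] at h2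
      linarith
    refine (dimH_mono hsub).trans ?_
    rw [dimH_iUnion]
    exact iSup_le fun N => dimH_le_of_cell_rpow_ge hℓ hZ (by linarith) N
  have hlim : Tendsto (fun δ => ENNReal.ofReal (α * q + δ + T)) (𝓝[>] 0)
      (𝓝 (ENNReal.ofReal (α * q + 0 + T))) := by
    refine ENNReal.tendsto_ofReal (Tendsto.mono_left ?_ nhdsWithin_le_nhds)
    exact Continuous.tendsto (by fun_prop) 0
  rw [add_zero] at hlim
  exact ge_of_tendsto hlim (eventually_mem_nhdsWithin.mono fun δ hδ => key δ hδ)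

end UpperBound

/-! ### The mass distribution principle -/

section MassDistribution

variable {ℓ : ℕ} {ν : Measure ℝ}

/-- A set of diameter at most `ℓ^{-n}` meets at most three cells of order `n`. -/
theorem measureReal_inter_le_of_ediam_le (hℓ : 0 < ℓ) [IsFiniteMeasure ν] {A U : Set ℝ} {n : ℕ}
    {b : ℝ} (hb : 0 ≤ b) (hA : ∀ x ∈ A, ν.real (adicCell ℓ n x) ≤ b)
    (hU : ∀ x ∈ U, ∀ y ∈ U, |x - y| ≤ ((ℓ : ℝ) ^ n)⁻¹) : ν.real (U ∩ A) ≤ 3 * b := by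
  rcases (U ∩ A).eq_empty_or_nonempty with he | ⟨x₀, hx₀U, -⟩
  · rw [he, measureReal_empty]
    positivity
  have hpos : (0 : ℝ) < (ℓ : ℝ) ^ n := by positivity
  set z := ⌊(ℓ : ℝ) ^ n * x₀⌋ with hz
  let piece : ℤ → Set ℝ := fun k => {x ∈ U ∩ A | ⌊(ℓ : ℝ) ^ n * x⌋ = k}
  have hpiece : ∀ k, ν.real (piece k) ≤ b := by
    intro k
    rcases (piece k).eq_empty_or_nonempty with he | ⟨x, hx, hxk⟩
    · rw [he, measureReal_empty]
      exact hb
    · refine (measureReal_mono fun y hy => ?_).trans (hA x hx.2)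
      have h1 : adicCell ℓ n x = adicCell ℓ n y := by rw [adicCell, adicCell, hxk, hy.2]
      rw [h1]
      exact mem_adicCell hℓ n y
  have hcover : U ∩ A ⊆ piece (z - 1) ∪ piece z ∪ piece (z + 1) := by
    intro x hx
    have h1 := hU x hx.1 x₀ hx₀U
    rw [abs_le] at h1
    have h2 : (ℓ : ℝ) ^ n * x - (ℓ : ℝ) ^ n * x₀ ≤ 1 := by
      rw [← mul_sub, ← mul_inv_cancel₀ hpos.ne']
      exact mul_le_mul_of_nonneg_left h1.2 hpos.le
    have h3 : -1 ≤ (ℓ : ℝ) ^ n * x - (ℓ : ℝ) ^ n * x₀ := by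
      rw [← mul_sub, ← mul_inv_cancel₀ hpos.ne', ← mul_neg]
      exact mul_le_mul_of_nonneg_left h1.1 hpos.le
    have h4 := Int.floor_le ((ℓ : ℝ) ^ n * x)
    have h5 := Int.lt_floor_add_one ((ℓ : ℝ) ^ n * x)
    have h6 := Int.floor_le ((ℓ : ℝ) ^ n * x₀)
    have h7 := Int.lt_floor_add_one ((ℓ : ℝ) ^ n * x₀)
    rw [← hz] at h6 h7
    set k := ⌊(ℓ : ℝ) ^ n * x⌋ with hk
    have h8 : k < z + 2 := by
      have : (k : ℝ) < ((z + 2 : ℤ) : ℝ) := by push_cast; linarith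
      exact_mod_cast this
    have h9 : z < k + 2 := by
      have : (z : ℝ) < ((k + 2 : ℤ) : ℝ) := by push_cast; linarith
      exact_mod_cast this
    have h10 : k = z - 1 ∨ k = z ∨ k = z + 1 := by omega
    rcases h10 with h | h | h
    · exact Or.inl (Or.inl ⟨hx, h⟩)
    · exact Or.inl (Or.inr ⟨hx, h⟩)
    · exact Or.inr ⟨hx, h⟩
  have h1 := measureReal_mono (μ := ν) hcover
  have h2 := measureReal_union_le (μ := ν) (piece (z - 1) ∪ piece z) (piece (z + 1))
  have h3 := measureReal_union_le (μ := ν) (piece (z - 1)) (piece z)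
  linarith [hpiece (z - 1), hpiece z, hpiece (z + 1)]

/-- Frostman's lower bound on a set where all cells of order at least `N` satisfy
`ν(I) ≤ |I|^d`. -/
theorem measure_inter_le_ediam_rpow (hℓ : 1 < ℓ) [IsFiniteMeasure ν] {A : Set ℝ} {d : ℝ}
    (hd : 0 < d) {N : ℕ}
    (hA : ∀ x ∈ A, ∀ n ≥ N, ν.real (adicCell ℓ n x) ≤ Real.exp (-(n * Real.log ℓ)) ^ d)
    {U : Set ℝ} (hU : Metric.ediam U ≤ ENNReal.ofReal (((ℓ : ℝ) ^ N)⁻¹)) :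
    ν (U ∩ A) ≤ ENNReal.ofReal (3 * (ℓ : ℝ) ^ d) * Metric.ediam U ^ d := by
  have hℓ1 : (1 : ℝ) < ℓ := by exact_mod_cast hℓ
  have hfin : Metric.ediam U ≠ ⊤ := ne_top_of_le_ne_top ENNReal.ofReal_ne_top hU
  set ρ := (Metric.ediam U).toReal with hρ
  have hdist : ∀ x ∈ U, ∀ y ∈ U, |x - y| ≤ ρ := by
    intro x hx y hy
    rw [← Real.dist_eq, dist_edist]
    exact ENNReal.toReal_mono hfin (Metric.edist_le_ediam_of_mem hx hy)
  rcases (ENNReal.toReal_nonneg : 0 ≤ ρ).lt_or_eq with hpos | h0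
  · have hρN : ρ ≤ ((ℓ : ℝ) ^ N)⁻¹ := by
      rw [hρ]
      exact ENNReal.toReal_le_of_le_ofReal (by positivity) hU
    have hρ1 : ρ ≤ 1 := hρN.trans (inv_le_one_of_one_le₀ (one_le_pow₀ hℓ1.le))
    obtain ⟨n, hn1, hn2⟩ := exists_nat_pow_near_of_lt_one hpos hρ1
      (inv_pos.2 (by positivity : (0 : ℝ) < ℓ)) (inv_lt_one_of_one_lt₀ hℓ1)
    rw [inv_pow] at hn1 hn2
    have hnN : N ≤ n := by
      by_contra! hcon
      have h1 : ((ℓ : ℝ) ^ N)⁻¹ ≤ ((ℓ : ℝ) ^ (n + 1))⁻¹ :=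
        inv_anti₀ (by positivity) (pow_le_pow_right₀ hℓ1.le hcon)
      linarith
    have h1 := measureReal_inter_le_of_ediam_le (ν := ν) (A := A) (U := U) (n := n)
      (by omega : 0 < ℓ) (Real.rpow_nonneg (Real.exp_pos _).le d) (fun x hx => hA x hx n hnN)
      fun x hx y hy => (hdist x hx y hy).trans hn2
    have h2 : Real.exp (-(n * Real.log ℓ)) ^ d ≤ (ℓ : ℝ) ^ d * ρ ^ d := by
      rw [exp_neg_mul_log_eq (by omega), ← Real.mul_rpow (by positivity) hpos.le]
      refine Real.rpow_le_rpow (by positivity) ?_ hd.le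
      rw [pow_succ, mul_inv, ← div_eq_mul_inv, div_lt_iff₀ (by positivity)] at hn1
      linarith
    rw [← ENNReal.ofReal_toReal hfin, ← hρ, ENNReal.ofReal_rpow_of_pos hpos,
      ← ENNReal.ofReal_mul (by positivity), ← ENNReal.ofReal_toReal (measure_ne_top ν (U ∩ A))]
    refine ENNReal.ofReal_le_ofReal (h1.trans ?_)
    rw [mul_assoc]
    exact mul_le_mul_of_nonneg_left h2 (by norm_num)
  · have hnull : ν.real (U ∩ A) ≤ 0 := by
      -- A set of diameter zero is covered by three cells of each order.
      have hlim : Tendsto (fun n : ℕ => 3 * Real.exp (-(n * Real.log ℓ)) ^ d) atTop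
          (𝓝 (3 * 0 ^ d)) :=
        ((tendsto_exp_neg_mul_log hℓ).rpow_const (Or.inr hd.le)).const_mul 3
      rw [Real.zero_rpow hd.ne', mul_zero] at hlim
      refine ge_of_tendsto hlim ?_
      filter_upwards [eventually_ge_atTop N] with n hn
      exact measureReal_inter_le_of_ediam_le (by omega : 0 < ℓ)
        (Real.rpow_nonneg (Real.exp_pos _).le d) (fun x hx => hA x hx n hn)
        fun x hx y hy => (hdist x hx y hy).trans (h0.ge.trans (by positivity))
    rw [(measureReal_eq_zero_iff).1 (le_antisymm hnull measureReal_nonneg)]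
    exact zero_le

/-- **Mass distribution principle** (Billingsley's lemma) for `ℓ`-adic cells: a set of positive
measure at each point of which `ν(I_n(x)) ≤ |I_n(x)|^d` eventually has dimension at least `d`. -/
theorem le_dimH_of_measure_adicCell_le (hℓ : 1 < ℓ) [IsFiniteMeasure ν] {G : Set ℝ}
    (hG : ν G ≠ 0) {d : NNReal} (hd : 0 < d)
    (h : ∀ x ∈ G, ∀ᶠ n : ℕ in atTop,
      ν.real (adicCell ℓ n x) ≤ Real.exp (-(n * Real.log ℓ)) ^ (d : ℝ)) :
    (d : ENNReal) ≤ dimH G := by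
  let A : ℕ → Set ℝ := fun N =>
    ⋂ n ≥ N, {x | ν.real (adicCell ℓ n x) ≤ Real.exp (-(n * Real.log ℓ)) ^ (d : ℝ)}
  have hAmeas : ∀ N, MeasurableSet (A N) := fun N =>
    MeasurableSet.iInter fun n => MeasurableSet.iInter fun _ =>
      measurableSet_le (measurable_measureReal_adicCell ν n) measurable_const
  obtain ⟨N, hN⟩ : ∃ N, ν (G ∩ A N) ≠ 0 := by
    by_contra! hcon
    refine hG (measure_mono_null (fun x hx => ?_) (measure_iUnion_null hcon))
    obtain ⟨N, hN⟩ := eventually_atTop.1 (h x hx)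
    exact mem_iUnion.2 ⟨N, hx, mem_iInter₂.2 hN⟩
  have hℓpos : (0 : ℝ) < ℓ := by positivity
  have hK0 : ENNReal.ofReal (3 * (ℓ : ℝ) ^ (d : ℝ)) ≠ 0 :=
    (ENNReal.ofReal_pos.2 (by positivity)).ne'
  have hle : (ENNReal.ofReal (3 * (ℓ : ℝ) ^ (d : ℝ)))⁻¹ • ν.restrict (A N) ≤
      Measure.hausdorffMeasure (d : ℝ) := by
    refine Measure.le_hausdorffMeasure _ _ (ENNReal.ofReal (((ℓ : ℝ) ^ N)⁻¹))
      (ENNReal.ofReal_pos.2 (by positivity)) fun U hU => ?_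
    rw [Measure.smul_apply, smul_eq_mul, Measure.restrict_apply' (hAmeas N), mul_comm,
      ← div_eq_mul_inv]
    refine ENNReal.div_le_of_le_mul' ?_
    exact measure_inter_le_ediam_rpow hℓ hd (fun x hx n hn => mem_iInter₂.1 hx n hn) hU
  refine le_dimH_of_hausdorffMeasure_ne_zero fun h0 => ?_
  have h1 := hle G
  rw [h0, Measure.smul_apply, smul_eq_mul, Measure.restrict_apply' (hAmeas N),
    nonpos_iff_eq_zero, mul_eq_zero] at h1
  rcases h1 with h1 | h1
  · exact ENNReal.inv_ne_zero.2 ENNReal.ofReal_ne_top h1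
  · exact hN h1

end MassDistribution

/-! ### Lower bound for the dimension of level sets -/

section LowerBound

variable {ℓ : ℕ} {m ν : Measure ℝ} {α q t T T' C C' β : ℝ}

/-- Chernoff's bound: the exponential moment of `log m(I_n(x))` under a Gibbs measure at `q` is
controlled by the partition sum at `q + t`. -/
theorem measureReal_large_deviation_le (hℓ : 0 < ℓ) [IsFiniteMeasure m] [IsFiniteMeasure ν]
    (hC : 0 ≤ C)
    (hν : ∀ (n : ℕ) (ε : Fin n → Fin ℓ), ν.real (adicInterval ε) ≤
      C * wordWeight m q ε * Real.exp (-(n * (Real.log ℓ * T))))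
    (hZ : ∀ n : ℕ, partitionSum ℓ m n (q + t) ≤ C' * Real.exp (n * (Real.log ℓ * T'))) (n : ℕ) :
    ν.real {x | x ∈ Ico (0 : ℝ) 1 ∧ 0 < m.real (adicCell ℓ n x) ∧
      0 ≤ t * (Real.log (m.real (adicCell ℓ n x)) + n * (Real.log ℓ * β))} ≤
      C * C' * Real.exp (Real.log ℓ * (T' - T + t * β)) ^ n := by
  set S := {x | x ∈ Ico (0 : ℝ) 1 ∧ 0 < m.real (adicCell ℓ n x) ∧
      0 ≤ t * (Real.log (m.real (adicCell ℓ n x)) + n * (Real.log ℓ * β))} with hS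
  have hterm : ∀ ε : Fin n → Fin ℓ, ν.real (S ∩ adicInterval ε) ≤
      C * Real.exp (n * (Real.log ℓ * (t * β - T))) * wordWeight m (q + t) ε := by
    intro ε
    rcases (S ∩ adicInterval ε).eq_empty_or_nonempty with he | ⟨x, hxS, hxε⟩
    · rw [he, measureReal_empty]
      exact mul_nonneg (mul_nonneg hC (Real.exp_pos _).le) (wordWeight_nonneg ε)
    · obtain ⟨-, hp, hdev⟩ := hxS
      rw [adicCell_eq_adicInterval hℓ ε hxε] at hp hdev
      refine (measureReal_mono inter_subset_right).trans ((hν n ε).trans ?_)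
      rw [wordWeight_eq_rpow hp, wordWeight_eq_rpow hp, Real.rpow_def_of_pos hp,
        Real.rpow_def_of_pos hp, mul_assoc, mul_assoc, ← Real.exp_add, ← Real.exp_add]
      refine mul_le_mul_of_nonneg_left (Real.exp_le_exp.2 ?_) hC
      nlinarith [hdev]
  have hcover : S ⊆ ⋃ ε : Fin n → Fin ℓ, S ∩ adicInterval ε := fun x hx =>
    let ⟨ε, hε⟩ := exists_mem_adicInterval hℓ n hx.1
    mem_iUnion.2 ⟨ε, hx, hε⟩
  calc ν.real S ≤ ν.real (⋃ ε : Fin n → Fin ℓ, S ∩ adicInterval ε) := measureReal_mono hcover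
    _ ≤ ∑ ε : Fin n → Fin ℓ, ν.real (S ∩ adicInterval ε) := measureReal_iUnion_fintype_le _
    _ ≤ ∑ ε : Fin n → Fin ℓ,
        C * Real.exp (n * (Real.log ℓ * (t * β - T))) * wordWeight m (q + t) ε :=
        Finset.sum_le_sum fun ε _ => hterm ε
    _ = C * Real.exp (n * (Real.log ℓ * (t * β - T))) * partitionSum ℓ m n (q + t) := by
        rw [← Finset.mul_sum, partitionSum_eq_sum_wordWeight]
    _ ≤ C * Real.exp (n * (Real.log ℓ * (t * β - T))) *
        (C' * Real.exp (n * (Real.log ℓ * T'))) :=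
        mul_le_mul_of_nonneg_left (hZ n) (mul_nonneg hC (Real.exp_pos _).le)
    _ = _ := by
        rw [← Real.exp_nat_mul, mul_mul_mul_comm, ← Real.exp_add]
        ring_nf

theorem ae_eventually_not_large_deviation (hℓ : 1 < ℓ) [IsFiniteMeasure m] [IsFiniteMeasure ν]
    (hC : 0 ≤ C)
    (hν : ∀ (n : ℕ) (ε : Fin n → Fin ℓ), ν.real (adicInterval ε) ≤
      C * wordWeight m q ε * Real.exp (-(n * (Real.log ℓ * T))))
    (hZ : ∀ n : ℕ, partitionSum ℓ m n (q + t) ≤ C' * Real.exp (n * (Real.log ℓ * T')))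
    (hneg : T' - T + t * β < 0) :
    ∀ᵐ x ∂ν, ∀ᶠ n : ℕ in atTop, x ∈ Ico (0 : ℝ) 1 → 0 < m.real (adicCell ℓ n x) →
      t * (Real.log (m.real (adicCell ℓ n x)) + n * (Real.log ℓ * β)) < 0 := by
  have hL : 0 < Real.log ℓ := Real.log_pos (by exact_mod_cast hℓ)
  have hsum : Summable fun n : ℕ => C * C' * Real.exp (Real.log ℓ * (T' - T + t * β)) ^ n :=
    (summable_geometric_of_lt_one (Real.exp_pos _).le
      (Real.exp_lt_one_iff.2 (mul_neg_of_pos_of_neg hL hneg))).mul_left _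
  have hae := ae_eventually_notMem (μ := ν) (s := fun n : ℕ => {x | x ∈ Ico (0 : ℝ) 1 ∧
      0 < m.real (adicCell ℓ n x) ∧
      0 ≤ t * (Real.log (m.real (adicCell ℓ n x)) + n * (Real.log ℓ * β))}) (by
    refine ne_top_of_le_ne_top hsum.tsum_ofReal_ne_top (ENNReal.tsum_le_tsum fun n => ?_)
    rw [← ENNReal.ofReal_toReal (measure_ne_top ν _)]
    exact ENNReal.ofReal_le_ofReal
      (measureReal_large_deviation_le (by omega) hC hν hZ n))
  filter_upwards [hae] with x hx
  filter_upwards [hx] with n hn h1 h2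
  by_contra! h3
  exact hn ⟨h1, h2, h3⟩

/-- A differentiable function decreases, up to an arbitrarily small linear error, on both sides of a
point after subtraction of its tangent. -/
theorem exists_increment_lt_of_hasDerivAt {τ : ℝ → ℝ} (hτ : HasDerivAt τ (-α) q) {δ : ℝ}
    (hδ : 0 < δ) : (∃ t > 0, τ (q + t) - τ q + t * (α - δ) < 0) ∧
      ∃ t < 0, τ (q + t) - τ q + t * (α + δ) < 0 := by
  have h := (Metric.tendsto_nhds.1 hτ.tendsto_slope_zero) δ hδ
  rw [eventually_nhdsWithin_iff, Metric.eventually_nhds_iff] at h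
  obtain ⟨η, hη, h⟩ := h
  have hη2 : |η / 2| < η := by rw [abs_of_pos (half_pos hη)]; exact half_lt_self hη
  constructor
  · refine ⟨η / 2, half_pos hη, ?_⟩
    have h1 := h (y := η / 2) (by rwa [dist_zero_right, Real.norm_eq_abs]) (half_pos hη).ne'
    rw [Real.dist_eq, smul_eq_mul, abs_lt] at h1
    have h2 := mul_lt_mul_of_pos_left h1.2 (half_pos hη)
    rw [mul_sub, ← mul_assoc, mul_inv_cancel₀ (half_pos hη).ne'] at h2
    linarith
  · refine ⟨-(η / 2), neg_lt_zero.2 (half_pos hη), ?_⟩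
    have h1 := h (y := -(η / 2)) (by rwa [dist_zero_right, Real.norm_eq_abs, abs_neg])
      (neg_ne_zero.2 (half_pos hη).ne')
    rw [Real.dist_eq, smul_eq_mul, abs_lt] at h1
    have h2 := mul_lt_mul_of_neg_left h1.1 (neg_lt_zero.2 (half_pos hη))
    rw [mul_sub, ← mul_assoc, mul_inv_cancel₀ (neg_ne_zero.2 (half_pos hη).ne')] at h2
    linarith

/-- A Gibbs measure at `q` is carried by the level set of exponent `-τ'(q)`. -/
theorem ae_mem_levelSet_of_gibbs (hℓ : 1 < ℓ) [IsFiniteMeasure m] [IsFiniteMeasure ν]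
    (hν01 : ν (Ico 0 1)ᶜ = 0) {τ : ℝ → ℝ} (hτ : HasDerivAt τ (-α) q) (hC : 0 ≤ C)
    (hν : ∀ (n : ℕ) (ε : Fin n → Fin ℓ), ν.real (adicInterval ε) ≤
      C * wordWeight m q ε * Real.exp (-(n * (Real.log ℓ * τ q))))
    (hZ : ∀ s, ∃ C' : ℝ, ∀ n : ℕ, partitionSum ℓ m n s ≤ C' * Real.exp (n * (Real.log ℓ * τ s))) :
    ∀ᵐ x ∂ν, x ∈ levelSet ℓ m α := by
  have hL : 0 < Real.log ℓ := Real.log_pos (by exact_mod_cast hℓ)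
  have hdev : ∀ k : ℕ, ∀ᵐ x ∂ν, ∀ᶠ n : ℕ in atTop, x ∈ Ico (0 : ℝ) 1 →
      0 < m.real (adicCell ℓ n x) →
      Real.log (m.real (adicCell ℓ n x)) + n * (Real.log ℓ * (α - 1 / ((k : ℝ) + 1))) < 0 ∧
      0 < Real.log (m.real (adicCell ℓ n x)) + n * (Real.log ℓ * (α + 1 / ((k : ℝ) + 1))) := by
    intro k
    obtain ⟨⟨t, ht, hlt⟩, s, hs, hls⟩ :=
      exists_increment_lt_of_hasDerivAt hτ (δ := 1 / ((k : ℝ) + 1)) (by positivity)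
    obtain ⟨C₁, hC₁⟩ := hZ (q + t)
    obtain ⟨C₂, hC₂⟩ := hZ (q + s)
    filter_upwards [ae_eventually_not_large_deviation hℓ hC hν hC₁ hlt,
      ae_eventually_not_large_deviation hℓ hC hν hC₂ hls] with x h1 h2
    filter_upwards [h1, h2] with n h3 h4 h5 h6
    exact ⟨(pos_iff_neg_of_mul_neg (h3 h5 h6)).1 ht, (neg_iff_pos_of_mul_neg (h4 h5 h6)).1 hs⟩
  have hpos : ∀ n : ℕ, ∀ᵐ x ∂ν, x ∈ Ico (0 : ℝ) 1 → 0 < m.real (adicCell ℓ n x) := by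
    intro n
    refine measure_mono_null (t := ⋃ ε ∈ {ε : Fin n → Fin ℓ | m.real (adicInterval ε) = 0},
      adicInterval ε) (fun x hx => ?_)
      ((measure_biUnion_null_iff (to_countable _)).2 fun ε hε => ?_)
    · simp only [mem_compl_iff, mem_ofPred_eq, Classical.not_imp, not_lt] at hx
      obtain ⟨ε, hxε, hε⟩ := exists_adicInterval_eq_adicCell (by omega : 0 < ℓ) n hx.1
      rw [hε] at hx
      exact mem_iUnion₂.2 ⟨ε, le_antisymm hx.2 measureReal_nonneg, hxε⟩
    · have h1 := hν n ε
      rw [wordWeight_eq_zero hε, mul_zero, zero_mul] at h1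
      exact (measureReal_eq_zero_iff).1 (le_antisymm h1 measureReal_nonneg)
  have h01 : ∀ᵐ x ∂ν, x ∈ Ico (0 : ℝ) 1 := hν01
  filter_upwards [h01, ae_all_iff.2 hdev, ae_all_iff.2 hpos] with x hx hxdev hxpos
  refine (mem_levelSet_iff (by omega)).2 ⟨hx, fun n => hxpos n hx, Metric.tendsto_nhds.2 ?_⟩
  intro δ hδ
  obtain ⟨k, hk⟩ := exists_nat_one_div_lt hδ
  filter_upwards [hxdev k, eventually_gt_atTop 0] with n hn hn0
  obtain ⟨h1, h2⟩ := hn hx (hxpos n hx)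
  have hnL : 0 < n * Real.log ℓ := mul_pos (by exact_mod_cast hn0) hL
  rw [Real.dist_eq]
  refine lt_trans ?_ hk
  rw [abs_lt, div_neg, neg_lt_sub_iff_lt_add, sub_lt_iff_lt_add, ← sub_lt_iff_lt_add', lt_neg,
    neg_lt, div_lt_iff₀ hnL, lt_div_iff₀ hnL]
  constructor <;> linarith

theorem le_dimH_levelSet_of_gibbs (hℓ : 1 < ℓ) [IsFiniteMeasure m] [IsProbabilityMeasure ν]
    (hmem : ∀ᵐ x ∂ν, x ∈ levelSet ℓ m α) (hC : 0 < C)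
    (hν : ∀ (n : ℕ) (ε : Fin n → Fin ℓ), ν.real (adicInterval ε) ≤
      C * wordWeight m q ε * Real.exp (-(n * (Real.log ℓ * T)))) :
    ENNReal.ofReal (α * q + T) ≤ dimH (levelSet ℓ m α) := by
  have hL : 0 < Real.log ℓ := Real.log_pos (by exact_mod_cast hℓ)
  refine ENNReal.le_of_forall_nnreal_lt fun d hd => ?_
  rcases eq_or_ne d 0 with rfl | hd0
  · simp
  rw [ENNReal.lt_ofReal_iff_toReal_lt ENNReal.coe_ne_top, ENNReal.coe_toReal] at hd
  refine le_dimH_of_measure_adicCell_le (ν := ν) hℓ (fun h0 => ?_) (pos_iff_ne_zero.2 hd0)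
    fun x hx => ?_
  · have h1 : ν (levelSet ℓ m α)ᶜ = 0 := hmem
    have h2 := measure_union_null h0 h1
    rw [union_compl_self, measure_univ] at h2
    exact one_ne_zero h2
  · obtain ⟨hx01, hpos, hlim⟩ := (mem_levelSet_iff (by omega)).1 hx
    have h1 : Tendsto (fun n : ℕ => Real.log (m.real (adicCell ℓ n x)) / -(n * Real.log ℓ) * q -
        Real.log C / Real.log ℓ * (n : ℝ)⁻¹ + T) atTop
        (𝓝 (α * q - Real.log C / Real.log ℓ * 0 + T)) :=
      ((hlim.mul_const q).sub (tendsto_inv_atTop_nhds_zero_nat.const_mul _)).add_const T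
    rw [mul_zero, sub_zero] at h1
    filter_upwards [h1.eventually_const_lt hd, eventually_gt_atTop 0] with n hn hn0
    have hn' : (0 : ℝ) < n := by exact_mod_cast hn0
    obtain ⟨ε, -, hε⟩ := exists_adicInterval_eq_adicCell (by omega : 0 < ℓ) n hx01
    have hp := hpos n
    rw [hε] at hp hn ⊢
    refine (hν n ε).trans ?_
    rw [wordWeight_eq_rpow hp, Real.rpow_def_of_pos hp, ← Real.exp_mul, ← Real.exp_log hC,
      ← Real.exp_add, ← Real.exp_add, Real.exp_le_exp]
    have h3 : Real.log (m.real (adicInterval ε)) / -(n * Real.log ℓ) * q -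
        Real.log C / Real.log ℓ * (n : ℝ)⁻¹ + T =
        (n * (Real.log ℓ * T) - Real.log (m.real (adicInterval ε)) * q - Real.log C) /
          (n * Real.log ℓ) := by
      field_simp
      ring
    rw [h3, lt_div_iff₀ (by positivity)] at hn
    linarith

/-- The multifractal formalism at a point where `τ` is differentiable and a Gibbs measure exists. -/
theorem dimH_levelSet_of_gibbs (hℓ : 1 < ℓ) [IsFiniteMeasure m] [IsProbabilityMeasure ν]
    (hν01 : ν (Ico 0 1)ᶜ = 0) {τ : ℝ → ℝ} (hτ : HasDerivAt τ (-α) q) (hC : 0 < C)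
    (hν : ∀ (n : ℕ) (ε : Fin n → Fin ℓ), ν.real (adicInterval ε) ≤
      C * wordWeight m q ε * Real.exp (-(n * (Real.log ℓ * τ q))))
    (hZ : ∀ s, ∃ C' : ℝ, ∀ n : ℕ, partitionSum ℓ m n s ≤ C' * Real.exp (n * (Real.log ℓ * τ s))) :
    0 ≤ α * q + τ q ∧ dimH (levelSet ℓ m α) = ENNReal.ofReal (α * q + τ q) := by
  have hmem := ae_mem_levelSet_of_gibbs hℓ hν01 hτ hC.le hν hZ
  obtain ⟨x, hx⟩ := hmem.exists
  obtain ⟨C', hC'⟩ := hZ q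
  have h0 := legendre_nonneg_of_mem_levelSet hℓ hx hC'
  exact ⟨h0, le_antisymm (dimH_levelSet_le hℓ hC' h0) (le_dimH_levelSet_of_gibbs hℓ hmem hC hν)⟩

end LowerBound

/-! ### The structure function and the multifractal formalism -/

section StructureFunction

open Matrix

variable {ℓ : ℕ}

/-- The infimum in the Legendre transform of a convex function is attained at a critical point. -/
theorem legendre_eq_of_hasDerivAt {τ : ℝ → ℝ} (hconv : ConvexOn ℝ univ τ) {α q : ℝ}
    (hτ : HasDerivAt τ (-α) q) : legendre τ α = ((α * q + τ q : ℝ) : EReal) := by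
  refine le_antisymm (iInf_le _ q) (le_iInf fun t => EReal.coe_le_coe_iff.2 ?_)
  rcases lt_trichotomy t q with h | rfl | h
  · have h1 := hconv.slope_le_of_hasDerivAt (mem_univ t) (mem_univ q) h hτ
    rw [slope_def_field, div_le_iff₀ (sub_pos.2 h)] at h1
    linarith
  · exact le_rfl
  · have h1 := hconv.le_slope_of_hasDerivAt (mem_univ q) (mem_univ t) h hτ
    rw [slope_def_field, le_div_iff₀ (sub_pos.2 h)] at h1
    linarith

/-- The structure function is a limit of logarithms of partition sums, each of which is convex. -/
theorem convexOn_of_tendsto_log_partitionSum {m : Measure ℝ} [IsFiniteMeasure m] {τ : ℝ → ℝ}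
    (hpos : ∀ n q, 0 < partitionSum ℓ m n q)
    (hlim : ∀ q, Tendsto (fun n : ℕ => 1 / ((n : ℝ) * Real.log ℓ) *
      Real.log (partitionSum ℓ m n q)) atTop (𝓝 (τ q))) : ConvexOn ℝ univ τ := by
  refine ⟨convex_univ, fun q₁ _ q₂ _ a b ha hb hab => ?_⟩
  refine le_of_tendsto_of_tendsto' (hlim _) (((hlim q₁).const_mul a).add ((hlim q₂).const_mul b))
    fun n => ?_
  simp only [smul_eq_mul]
  have h1 := Real.log_le_log (hpos n _)
    (partitionSum_convex_combination_le ha hb hab (hpos n q₁) (hpos n q₂))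
  rw [Real.log_mul (Real.rpow_pos_of_pos (hpos n q₁) a).ne'
    (Real.rpow_pos_of_pos (hpos n q₂) b).ne', Real.log_rpow (hpos n q₁),
    Real.log_rpow (hpos n q₂)] at h1
  have hnL : 0 ≤ 1 / ((n : ℝ) * Real.log ℓ) := by positivity
  have := mul_le_mul_of_nonneg_left h1 hnL
  linarith

/-- The derivative of the Perron root of `(p_ij^q)` is `r(q)` times a weighted mean of the numbers
`log p_ij`. -/
theorem perron_root_derivative_bounds [Nonempty (Fin ℓ)]
    {P : Matrix (Fin ℓ) (Fin ℓ) ℝ}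
    (hP : P ∈ rowStochastic ℝ (Fin ℓ)) {q r κ : ℝ} {u v : Fin ℓ → ℝ} (hu : ∀ i, 0 < u i)
    (hv : ∀ i, 0 < v i) (hAv : powMatrix P q *ᵥ v = r • v)
    (hκ : ∀ i j, κ ≤ Real.log (P i j)) :
    κ * r ≤ (u ⬝ᵥ (fun i j => powMatrix P q i j * Real.log (P i j)) *ᵥ v) / (u ⬝ᵥ v) ∧
      (u ⬝ᵥ (fun i j => powMatrix P q i j * Real.log (P i j)) *ᵥ v) / (u ⬝ᵥ v) ≤ 0 := by
  have hP0 : ∀ i j, 0 ≤ P i j := fun i j => nonneg_of_mem_rowStochastic hP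
  have hA : ∀ i j, 0 ≤ powMatrix P q i j := powMatrix_nonneg hP0
  have huv : 0 < u ⬝ᵥ v := Finset.sum_pos (fun i _ => mul_pos (hu i) (hv i)) Finset.univ_nonempty
  rw [le_div_iff₀ huv, div_le_iff₀ huv, zero_mul]
  constructor
  · have h1 : κ * r * (u ⬝ᵥ v) = u ⬝ᵥ (κ • (powMatrix P q *ᵥ v)) := by
      rw [hAv, dotProduct_smul, dotProduct_smul, smul_eq_mul, smul_eq_mul, mul_assoc]
    rw [h1]
    refine Finset.sum_le_sum fun i _ => mul_le_mul_of_nonneg_left ?_ (hu i).le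
    simp only [Pi.smul_apply, mulVec, dotProduct, smul_eq_mul, Finset.mul_sum]
    refine Finset.sum_le_sum fun j _ => ?_
    have h2 := mul_le_mul_of_nonneg_left (hκ i j) (mul_nonneg (hA i j) (hv j).le)
    linarith
  · refine Finset.sum_nonpos fun i _ => mul_nonpos_of_nonneg_of_nonpos (hu i).le ?_
    simp only [mulVec, dotProduct]
    exact Finset.sum_nonpos fun j _ => mul_nonpos_of_nonpos_of_nonneg
      (mul_nonpos_of_nonneg_of_nonpos (hA i j) (Real.log_nonpos (hP0 i j)
        (le_one_of_mem_rowStochastic hP))) (hv j).le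

/-- A convex function with bounded derivative has limiting slopes at both ends, and the derivative
takes all values strictly between them. -/
theorem exists_limits_deriv_of_convexOn {τ : ℝ → ℝ} (hconv : ConvexOn ℝ univ τ)
    (hdiff : Differentiable ℝ τ) {c : ℝ} (hc : ∀ q, c ≤ deriv τ q) (h0 : ∀ q, deriv τ q ≤ 0) :
    ∃ a b : ℝ, Tendsto (deriv τ) atTop (𝓝 a) ∧ Tendsto (deriv τ) atBot (𝓝 b) ∧
      ∀ α : ℝ, -a < α → α < -b → ∃ q, HasDerivAt τ (-α) q := by
  have hmono : Monotone (deriv τ) := fun x y hxy =>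
    hconv.monotoneOn_deriv (fun x _ => hdiff x) (mem_univ x) (mem_univ y) hxy
  have ha := tendsto_atTop_ciSup hmono ⟨0, forall_mem_range.2 h0⟩
  have hb := tendsto_atBot_ciInf hmono ⟨c, forall_mem_range.2 hc⟩
  refine ⟨_, _, ha, hb, fun α h1 h2 => ?_⟩
  obtain ⟨q₁, hq₁⟩ := (ha.eventually_const_lt (neg_lt.1 h1)).exists
  obtain ⟨q₂, hq₂⟩ := (hb.eventually_lt_const (lt_neg.1 h2)).exists
  obtain ⟨q, -, hq⟩ := (ordConnected_univ.image_deriv fun x _ => hdiff x).out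
    (mem_image_of_mem _ (mem_univ q₂)) (mem_image_of_mem _ (mem_univ q₁)) ⟨hq₂.le, hq₁.le⟩
  exact ⟨q, hq ▸ (hdiff q).hasDerivAt⟩

/-- The multifractal formalism for a given driven measure: `τ = log r / log ℓ` is convex and
differentiable with bounded derivative, and for `α` in the range of `-τ'` the Gibbs measure at a
solution of `τ'(q) = -α` determines the dimension of the level set. -/
theorem multifractal_formalism_of_isMarkovChain (hℓ : 1 < ℓ) {Ω : Type*} [MeasurableSpace Ω]
    {μ : Measure Ω} [IsProbabilityMeasure μ] {P : Matrix (Fin ℓ) (Fin ℓ) ℝ} {X : ℕ → Ω → Fin ℓ}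
    (hX : IsMarkovChain μ P X) (hirr : P.IsIrreducible) (hne : ∀ i j, P i j ≠ 1) {m : Measure ℝ}
    (hm : IsDrivenMeasure μ X m) :
    Differentiable ℝ (structureFunction ℓ m) ∧
      ∃ a b : ℝ,
        Tendsto (deriv (structureFunction ℓ m)) atTop (𝓝 a) ∧
        Tendsto (deriv (structureFunction ℓ m)) atBot (𝓝 b) ∧
        ∀ α : ℝ, -a < α → α < -b →
          ((dimH (levelSet ℓ m α) : ENNReal) : EReal) = legendre (structureFunction ℓ m) α := by
  have := hm.isProbabilityMeasure
  have hnonempty : Nonempty (Fin ℓ) := ⟨⟨0, by omega⟩⟩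
  have hL : 0 < Real.log ℓ := Real.log_pos (by exact_mod_cast hℓ)
  choose r hr v hv u hvpos hupos hAv hAu using fun q =>
    exists_perron_left_right (powMatrix_isIrreducible hirr q)
  choose c C hc hC hZ using fun q =>
    partitionSum_bounds (by omega) hX hm (hr q) (hvpos q) (hAv q)
  have hlim := fun q => tendsto_log_partitionSum hℓ (hr q) (hc q) (hC q) (hZ q)
  have hτ : structureFunction ℓ m = fun q => Real.log (r q) / Real.log ℓ :=
    funext fun q => (hlim q).limsup_eq
  rw [hτ]
  set τ : ℝ → ℝ := fun q => Real.log (r q) / Real.log ℓ with hτdef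
  have hexp : ∀ (q : ℝ) (n : ℕ), Real.exp (n * (Real.log ℓ * τ q)) = r q ^ n := by
    intro q n
    rw [Real.exp_nat_mul, hτdef, mul_div_cancel₀ _ hL.ne', Real.exp_log (hr q)]
  have hderiv : ∀ q, HasDerivAt τ ((u q ⬝ᵥ (fun i j => powMatrix P q i j * Real.log (P i j)) *ᵥ
      v q) / (u q ⬝ᵥ v q) / r q / Real.log ℓ) q := fun q =>
    ((hasDerivAt_perron_root (fun q => powMatrix_isIrreducible hirr q) hv hvpos (hupos q) hAv
      (hAu q) (hasDerivAt_powMatrix hirr.nonneg q)).log (hr q).ne').div_const _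
  have hdiff : Differentiable ℝ τ := fun q => (hderiv q).differentiableAt
  have hconv : ConvexOn ℝ univ τ := convexOn_of_tendsto_log_partitionSum
    (fun n q => (mul_pos (hc q) (pow_pos (hr q) n)).trans_le (hZ q n).1) hlim
  obtain ⟨p, hp⟩ := Finite.exists_min fun p : Fin ℓ × Fin ℓ => Real.log (P p.1 p.2)
  have hbounds : ∀ q, Real.log (P p.1 p.2) / Real.log ℓ ≤ deriv τ q ∧ deriv τ q ≤ 0 := by
    intro q
    obtain ⟨h1, h2⟩ := perron_root_derivative_bounds hX.stochastic (hupos q) (hvpos q) (hAv q)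
      fun i j => hp (i, j)
    rw [(hderiv q).deriv]
    refine ⟨div_le_div_of_nonneg_right ?_ hL.le,
      div_nonpos_of_nonpos_of_nonneg (div_nonpos_of_nonpos_of_nonneg h2 (hr q).le) hL.le⟩
    rwa [le_div_iff₀ (hr q)]
  obtain ⟨a, b, ha, hb, hab⟩ := exists_limits_deriv_of_convexOn hconv hdiff
    (fun q => (hbounds q).1) fun q => (hbounds q).2
  refine ⟨hdiff, a, b, ha, hb, fun α h1 h2 => ?_⟩
  obtain ⟨q, hq⟩ := hab α h1 h2
  obtain ⟨ν, hνprob, hν01, K, hK, hν⟩ := exists_gibbs_measure hℓ hX hne hm (hr q) (hvpos q) (hAv q)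
  obtain ⟨h0, hdim⟩ := dimH_levelSet_of_gibbs hℓ hν01 hq hK
    (fun n ε => by rw [Real.exp_neg, hexp]; exact hν n ε)
    fun s => ⟨C s, fun n => by rw [hexp]; exact (hZ s n).2⟩
  rw [hdim, legendre_eq_of_hasDerivAt hconv hq, EReal.coe_ennreal_ofReal, max_eq_left h0]

end StructureFunction

end MarkovMultifractal

end

theorem mainTheorem1 {Ω : Type*} [MeasurableSpace Ω] (μ : Measure Ω) [IsProbabilityMeasure μ]
    (ℓ : ℕ) (hℓ : 2 ≤ ℓ) (P : Matrix (Fin ℓ) (Fin ℓ) ℝ) (X : ℕ → Ω → Fin ℓ)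
    (hX : MarkovMultifractal.IsMarkovChain μ P X)
    (hirr : P.IsIrreducible)
    (hne : ∀ i j, P i j ≠ 1) :
    (∃! m : Measure ℝ, MarkovMultifractal.IsDrivenMeasure μ X m) ∧
    ∀ m : Measure ℝ, MarkovMultifractal.IsDrivenMeasure μ X m →
      Differentiable ℝ (MarkovMultifractal.structureFunction ℓ m) ∧
      ∃ a b : ℝ,
        Tendsto (deriv (MarkovMultifractal.structureFunction ℓ m)) atTop (𝓝 a) ∧
        Tendsto (deriv (MarkovMultifractal.structureFunction ℓ m)) atBot (𝓝 b) ∧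
        ∀ α : ℝ, -a < α → α < -b →
          ((dimH (MarkovMultifractal.levelSet ℓ m α) : ENNReal) : EReal) =
            MarkovMultifractal.legendre (MarkovMultifractal.structureFunction ℓ m) α := by
  refine ⟨?_, fun m hm =>
    MarkovMultifractal.multifractal_formalism_of_isMarkovChain (by omega) hX hirr hne hm⟩
  obtain ⟨m, hm⟩ := MarkovMultifractal.exists_isDrivenMeasure (by omega) hX.measurable
    (hX.ae_exists_ne (lt_of_le_of_ne (Matrix.le_one_of_mem_rowStochastic hX.stochastic)
      (hne _ _)))
  exact ⟨m, hm, fun m' hm' => hm'.unique hℓ hm⟩
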